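/- **Theorem.** Let $K$ be a field and let $E=(E^0,E^1,r,s)$ be an arbitrary directed graph (no restriction on the cardinalities of $E^0$ and $E^1$). A vertex $v$ of a graph is *regular* if $1\le |s^{-1}(v)|<\infty$, and *singular* otherwise, i.e. if it is a sink or an infinite emitter; it is an *uncountable emitter* if $s^{-1}(v)$ is uncountable. A graph is *row-finite* if $s^{-1}(v)$ is finite for every vertex $v$. The Leavitt path algebra $L(E)=L_K(E)$ is the (not necessarily unital) $K$-algebra generated by the vertices $v$, the edges $e$ and the ghost edges $e^*$, subject to the relations: $vv'=\delta_{v,v'}v$; $s(e)e=e=e\,r(e)$; $r(e)e^*=e^*=e^*s(e)$; $e^*f=\delta_{e,f}\,r(e)$; and $v=\sum_{s(e)=v}ee^*$ for every regular vertex $v$. Two such rings $R$, $S$ are *Morita equivalent* if the categories of unital left modules ($RM=M$, resp. $SM=M$) are equivalent. A *row-finite equivalent* of $E$ is a row-finite graph $F$ such that $L(E)$ and $L(F)$ are Morita equivalent. A *desingularization* of $E$ is a graph $F$ without singular vertices such that $L(E)$ and $L(F)$ are Morita equivalent. If no vertex of $E$ emits uncountably many edges, one may list, for each infinite emitter $v$,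 its edges as $e_0,e_1,e_2,\dots$ without repetition. The graph $F$ obtained from $E$ by *adding a tail at each singular vertex* with respect to such listings is formed as follows: to each singular vertex $v=v_0$ attach new vertices $v_1,v_2,\dots$ and new edges $v_n\to v_{n+1}$ ($n\ge 0$); and if $v$ is an infinite emitter, replace each edge $e_n\in s^{-1}(v)$ by an edge from $v_n$ to $r(e_n)$. The following are equivalent: 1. $E$ has a row-finite equivalent; 2. $E$ has a desingularization; 3. there is a choice of listings of the edges of the infinite emitters of $E$ for which the graph obtained from $E$ by adding a tail at each singular vertex is a desingularization of $E$; 4. no vertex of $E$ emits uncountably many edges. Moreover, for every choice of such listings, the graph $F$ obtained from $E$ by adding a tail at each singular vertex is a desingularization of $E$, and there is an injective homomorphism of $K$-algebras $\phi:L(E)\to L(F)$ with $\phi(v)=v$ for all $v\in E^0$, such that $\phi\bigl(tL(E)t\bigr)=\phi(t)L(F)\phi(t)$ for every finite sum $t=\sum_{v\in A}v$ of distinct vertices of $E$. -/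

import Mathlib

open CategoryTheory

universe u w t

/-- A directed graph `(E⁰, E¹, r, s)`: loops and parallel edges are allowed, and there is no
restriction on the cardinalities of the sets of vertices and of edges. -/
structure DirectedGraph where
  Vertex : Type u
  Edge : Type u
  source : Edge → Vertex
  range : Edge → Vertex

namespace DirectedGraph

variable (E : DirectedGraph.{u})

/-- The set `s⁻¹(v)` of edges emitted by the vertex `v`. -/
def emitted (v : E.Vertex) : Set E.Edge := {e | E.source e = v}

/-- A vertex is regular if it emits at least one and at most finitely many edges. -/
def IsRegular (v : E.Vertex) : Prop := (E.emitted v).Nonempty ∧ (E.emitted v).Finite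

/-- A vertex is singular if it is not regular: it is a sink or an infinite emitter. -/
def IsSingular (v : E.Vertex) : Prop := ¬ E.IsRegular v

def IsInfiniteEmitter (v : E.Vertex) : Prop := (E.emitted v).Infinite

def IsUncountableEmitter (v : E.Vertex) : Prop := ¬ (E.emitted v).Countable

/-- A graph is row-finite if each vertex emits at most finitely many edges (sinks are allowed). -/
def RowFinite : Prop := ∀ v : E.Vertex, (E.emitted v).Finite

/-! ### Leavitt path algebras -/

/-- The generators of the Leavitt path algebra: vertices `v`, edges `e` and ghost edges `e*`. -/
inductive Generator (E : DirectedGraph.{u}) : Type u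
  | vertex (v : E.Vertex)
  | edge (e : E.Edge)
  | ghost (e : E.Edge)

section Leavitt

variable (K : Type w) [Field K]

/-- The generator `v` in the free algebra. -/
def freeVertex (v : E.Vertex) : FreeAlgebra K E.Generator := FreeAlgebra.ι K (.vertex v)

/-- The generator `e` in the free algebra. -/
def freeEdge (e : E.Edge) : FreeAlgebra K E.Generator := FreeAlgebra.ι K (.edge e)

/-- The generator `e*` in the free algebra. -/
def freeGhost (e : E.Edge) : FreeAlgebra K E.Generator := FreeAlgebra.ι K (.ghost e)

/-- The defining relations of the Leavitt path algebra. -/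
inductive LeavittRel : FreeAlgebra K E.Generator → FreeAlgebra K E.Generator → Prop
  /-- vertices are pairwise orthogonal idempotents -/
  | vertex_mul_self (v : E.Vertex) :
      LeavittRel (E.freeVertex K v * E.freeVertex K v) (E.freeVertex K v)
  | vertex_mul_of_ne (v v' : E.Vertex) (h : v ≠ v') :
      LeavittRel (E.freeVertex K v * E.freeVertex K v') 0
  /-- `s(e) e = e = e r(e)` -/
  | source_mul_edge (e : E.Edge) :
      LeavittRel (E.freeVertex K (E.source e) * E.freeEdge K e) (E.freeEdge K e)
  | edge_mul_range (e : E.Edge) :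
      LeavittRel (E.freeEdge K e * E.freeVertex K (E.range e)) (E.freeEdge K e)
  /-- `r(e) e* = e* = e* s(e)` -/
  | range_mul_ghost (e : E.Edge) :
      LeavittRel (E.freeVertex K (E.range e) * E.freeGhost K e) (E.freeGhost K e)
  | ghost_mul_source (e : E.Edge) :
      LeavittRel (E.freeGhost K e * E.freeVertex K (E.source e)) (E.freeGhost K e)
  /-- first Cuntz-Krieger relation: `e* e = r(e)`, and `e* f = 0` for `e ≠ f` -/
  | ghost_mul_self (e : E.Edge) :
      LeavittRel (E.freeGhost K e * E.freeEdge K e) (E.freeVertex K (E.range e))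
  | ghost_mul_of_ne (e f : E.Edge) (h : e ≠ f) :
      LeavittRel (E.freeGhost K e * E.freeEdge K f) 0
  /-- second Cuntz-Krieger relation: `v` is the sum of the `e e*` over all edges `e` emitted
  by `v`, for every regular vertex `v` -/
  | vertex_eq_sum (v : E.Vertex) (h : E.IsRegular v) :
      LeavittRel (E.freeVertex K v) (∑ e ∈ h.2.toFinset, E.freeEdge K e * E.freeGhost K e)

/-- The unital `K`-algebra with the generators and relations of the Leavitt path algebra.
As no relation involves a constant term, it is the Leavitt path algebra with a unit adjoined. -/
abbrev UnitalLeavittAlgebra : Type (max u w) := RingQuot (E.LeavittRel K)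

/-- The image of a generator in the unital algebra. -/
noncomputable def unitalGenerator (g : E.Generator) : E.UnitalLeavittAlgebra K :=
  RingQuot.mkAlgHom K (E.LeavittRel K) (FreeAlgebra.ι K g)

/-- The Leavitt path algebra `L_K(E)`, in general an algebra without unit: the `K`-linear span of
all nonempty products of generators, that is, the free non-unital `K`-algebra on the vertices,
edges and ghost edges modulo the ideal generated by the defining relations. -/
abbrev LeavittPathAlgebra : Type (max u w) :=
  NonUnitalAlgebra.adjoin K (Set.range (E.unitalGenerator K))

/-- The vertex `v` as an element of `L_K(E)`. -/
noncomputable def leavittVertex (v : E.Vertex) : E.LeavittPathAlgebra K :=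
  ⟨E.unitalGenerator K (.vertex v), NonUnitalAlgebra.subset_adjoin K ⟨_, rfl⟩⟩

end Leavitt

end DirectedGraph

/-! ### Morita equivalence of rings without unit -/

/-- A left module over a not necessarily unital ring `R` is the same as a module over the ring
`ℤ ⊕ R` with a unit adjoined. It is called unital if `RM = M`: every element is a finite
sum of elements `r m` with `r ∈ R` and `m ∈ M`. -/
def IsUnitalModule (R : Type t) [NonUnitalRing R] :
    ObjectProperty (ModuleCat.{t} (Unitization ℤ R)) := fun M =>
  AddSubgroup.closure {x : M | ∃ (r : R) (m : M), x = (Unitization.inr r : Unitization ℤ R) • m} = ⊤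

/-- The category `R-Mod` of unital left modules over `R`, with all `R`-linear maps. -/
abbrev UnitalModuleCat (R : Type t) [NonUnitalRing R] : Type (t + 1) :=
  (IsUnitalModule R).FullSubcategory

/-- Rings (with local units) are Morita equivalent if their categories of unital left modules
are equivalent. -/
def MoritaEquivalentRings (R S : Type t) [NonUnitalRing R] [NonUnitalRing S] : Prop :=
  Nonempty (UnitalModuleCat R ≌ UnitalModuleCat S)

namespace DirectedGraph

section Equivalents

variable (K : Type w) [Field K] (E F : DirectedGraph.{u})

/-- `F` is a row-finite equivalent of `E`. -/
structure IsRowFiniteEquivalent : Prop where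
  rowFinite : F.RowFinite
  morita : MoritaEquivalentRings (E.LeavittPathAlgebra K) (F.LeavittPathAlgebra K)

/-- `F` is a desingularized equivalent, or desingularization, of `E`: it has no singular vertices
and its Leavitt path algebra is Morita equivalent to that of `E`. -/
structure IsDesingularization : Prop where
  not_singular : ∀ v : F.Vertex, ¬ F.IsSingular v
  morita : MoritaEquivalentRings (E.LeavittPathAlgebra K) (F.LeavittPathAlgebra K)

end Equivalents

/-! ### Adding tails -/

section Tails

variable (E : DirectedGraph.{u})

/-- A listing `e₀, e₁, e₂, …` (without repetition) of the edges emitted by `v`, for each infinite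
emitter `v` of `E`. -/
abbrev EdgeListing : Type u :=
  ∀ v : E.Vertex, E.IsInfiniteEmitter v → (ℕ ≃ E.emitted v)

/-- The vertex `vₙ` on the tail `v = v₀ → v₁ → v₂ → …` that is added at the singular vertex `v`. -/
def tailVertex (v : {v : E.Vertex // E.IsSingular v}) :
    ℕ → E.Vertex ⊕ ({v : E.Vertex // E.IsSingular v} × ℕ)
  | 0 => .inl v
  | n + 1 => .inr (v, n)

variable {E}

theorem IsInfiniteEmitter.isSingular {v : E.Vertex} (h : E.IsInfiniteEmitter v) :
    E.IsSingular v := fun hr => h hr.2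

open Classical in
/-- The graph obtained from `E` by adding a tail at each singular vertex. Its edges are
* for each edge `e` of `E`, an edge with the same range; it starts at `s(e)` if `s(e)` is
  regular, and at the vertex `vₙ` of the tail of `v` if `e` is the entry `eₙ` in the listing of
  the edges emitted by the infinite emitter `v` (so it replaces the edge `e` by the edge `gₙ`);
* for each singular vertex `v` and each `n`, the tail edge `vₙ → vₙ₊₁`. -/
noncomputable def addTails (L : E.EdgeListing) : DirectedGraph.{u} where
  Vertex := E.Vertex ⊕ ({v : E.Vertex // E.IsSingular v} × ℕ)
  Edge := E.Edge ⊕ ({v : E.Vertex // E.IsSingular v} × ℕ)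
  source
    | .inl e =>
        if h : E.IsInfiniteEmitter (E.source e) then
          E.tailVertex ⟨E.source e, h.isSingular⟩ ((L (E.source e) h).symm ⟨e, rfl⟩)
        else .inl (E.source e)
    | .inr (v, n) => E.tailVertex v n
  range
    | .inl e => .inl (E.range e)
    | .inr (v, n) => E.tailVertex v (n + 1)

/-- A vertex of `E` as a vertex of the graph with tails. -/
def addTailsVertex (L : E.EdgeListing) (v : E.Vertex) : (E.addTails L).Vertex := Sum.inl v

end Tails

/-- The element `t = ∑_{v ∈ A} v` of `L_K(E)`, for a finite set `A` of vertices. -/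
noncomputable def vertexSum (K : Type w) [Field K] (E : DirectedGraph.{u})
    (A : Finset E.Vertex) : E.LeavittPathAlgebra K :=
  ∑ v ∈ A, E.leavittVertex K v

end DirectedGraph

/-- The corner `t R t` of a ring `R`. -/
def cornerSet {R : Type t} [NonUnitalRing R] (x : R) : Set R := {y | ∃ a : R, y = x * a * x}

/-! ### Unital modules over rings with local units -/

section UnitalModules

attribute [-instance] Unitization.instNonAssocSemiring Unitization.instNonAssocRing
  Unitization.instSemiring Unitization.instMonoid Unitization.instMulOneClass

/-! The proof has two halves: when listings exist, `L(E)` is a full corner of `L(F)` for the graph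
`F` with tails; conversely, a Morita equivalence with a row-finite graph bounds the number of edges
at each vertex.

For the first half, let `fₙ : vₙ → vₙ₊₁` be the tail edges, `pₙ = f₀⋯fₙ₋₁`, and `gₙ` the edge that
replaces `eₙ`. Sending `v` to `v`, `eₙ` to `pₙgₙ` and `eₙ*` to `gₙ*pₙ*` respects the Leavitt
relations of `E`. The second Cuntz-Krieger relation at `vₙ` gives `pₙ₊₁pₙ₊₁* = pₙpₙ* - φ(eₙeₙ*)`, so
every `pₙpₙ*` lies in the image of `φ`. Inserting `x = pₓ*pₓ` between the factors of a product then
puts `φ(t)L(F)φ(t)` in the image (`tailPath_mul_mem`). The image is full, since each vertex `x` of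
`F` is `pₓ* v pₓ` with `v` the base of its tail. Injectivity needs no grading or uniqueness theorem:
`L(F)` is represented by matrices over the unital algebra of `E`, with `vₙ` acting as `v - e₀e₀* - ⋯
- eₙ₋₁eₙ₋₁*`, and this representation composed with `φ` contains left multiplication of `L(E)`
(`lift_unitalTailHom_columnEmb`). Finally, for a full corner `A` of `B`, both with local units, `M ↦
AM` is an equivalence of module categories (`IsFullCorner.moritaEquivalent`).

For the second half, the elements `ee*`, for `e` emitted by `v`, are nonzero orthogonal idempotents
below `v`, so they give orthogonal idempotent endomorphisms of the cyclic module `L(E)v`. An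
equivalence carries this module to a finitely generated one (`exists_finset_span_eq_top`), with
equally many orthogonal nonzero idempotents. Its generators are fixed by one finite sum `t` of
vertices of `F`, and `tL(F)t` has countable dimension as soon as `F` has no uncountable emitters
(`exists_rank_corner_le_aleph0`). Choosing one nonzero vector in the image of each idempotent gives
linearly independent elements of a space of countable dimension, so there are only countably many
edges at `v`. -/

/-- A ring has local units if every finite subset has a common two-sided unit. -/
def HasLocalUnits (R : Type*) [NonUnitalRing R] : Prop :=
  ∀ s : Finset R, ∃ e : R, ∀ a ∈ s, e * a = a ∧ a * e = a

/-- The action of a ring without unit on a module over its unitization. -/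
def nuAct {R M : Type*} [NonUnitalRing R] [AddCommGroup M] [Module (Unitization ℤ R) M]
    (r : R) (m : M) : M := (Unitization.inr r : Unitization ℤ R) • m

local infixr:73 " ⊳ " => nuAct

section Basic

variable {R M N : Type*} [NonUnitalRing R] [AddCommGroup M] [Module (Unitization ℤ R) M]
  [AddCommGroup N] [Module (Unitization ℤ R) N]

theorem mul_nuAct (r s : R) (m : M) : (r * s) ⊳ m = r ⊳ s ⊳ m := by
  simp only [nuAct]
  rw [Unitization.inr_mul]
  exact mul_smul (Unitization.inr r : Unitization ℤ R) _ m

theorem add_nuAct (r s : R) (m : M) : (r + s) ⊳ m = r ⊳ m + s ⊳ m := by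
  simp only [nuAct]
  rw [Unitization.inr_add]
  exact add_smul (Unitization.inr r : Unitization ℤ R) _ m

theorem neg_nuAct (r : R) (m : M) : (-r) ⊳ m = -(r ⊳ m) := by
  simp only [nuAct]
  rw [Unitization.inr_neg]
  exact neg_smul (Unitization.inr r : Unitization ℤ R) m

@[simp] theorem zero_nuAct (m : M) : (0 : R) ⊳ m = 0 := by
  have h := add_nuAct (0 : R) 0 m
  rwa [add_zero, left_eq_add] at h

@[simp] theorem nuAct_zero (r : R) : r ⊳ (0 : M) = 0 :=
  smul_zero (Unitization.inr r : Unitization ℤ R)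

theorem nuAct_add (r : R) (m n : M) : r ⊳ (m + n) = r ⊳ m + r ⊳ n :=
  smul_add (Unitization.inr r : Unitization ℤ R) m n

theorem nuAct_neg (r : R) (m : M) : r ⊳ (-m) = -(r ⊳ m) :=
  smul_neg (Unitization.inr r : Unitization ℤ R) m

theorem nuAct_sum {ι : Type*} (s : Finset ι) (r : R) (f : ι → M) :
    r ⊳ (∑ i ∈ s, f i) = ∑ i ∈ s, r ⊳ f i :=
  Finset.smul_sum (r := (Unitization.inr r : Unitization ℤ R))

theorem sum_nuAct {ι : Type*} (s : Finset ι) (f : ι → R) (m : M) :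
    (∑ i ∈ s, f i) ⊳ m = ∑ i ∈ s, f i ⊳ m := by
  classical
  induction s using Finset.induction_on with
  | empty => simp
  | insert i s hi ih => simp [Finset.sum_insert hi, add_nuAct, ih]

@[simp] theorem map_nuAct (f : M →ₗ[Unitization ℤ R] N) (r : R) (m : M) :
    f (r ⊳ m) = r ⊳ f m := f.map_smul _ _

theorem unitization_smul_eq (x : Unitization ℤ R) (m : M) :
    x • m = x.fst • m + x.snd ⊳ m := by
  conv_lhs => rw [← Unitization.inl_fst_add_inr_snd_eq x]
  refine (add_smul (Unitization.inl x.fst : Unitization ℤ R) _ m).trans ?_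
  congr 1
  have : (Unitization.inl x.fst : Unitization ℤ R) = x.fst • (1 : Unitization ℤ R) := by
    ext <;> simp
  rw [this]
  refine ((LinearMap.toSpanSingleton (Unitization ℤ R) M m).toAddMonoidHom.map_zsmul _ _).trans ?_
  exact congrArg _ (one_smul _ m)

/-- An additive map that respects the actions of `R` is linear over the unitization. -/
def linearMapOfNuAct (f : M →+ N) (h : ∀ (r : R) m, f (r ⊳ m) = r ⊳ f m) :
    M →ₗ[Unitization ℤ R] N where
  toFun := f
  map_add' := f.map_add
  map_smul' x m := by
    rw [unitization_smul_eq, unitization_smul_eq, map_add, map_zsmul, h]; rfl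

variable (R M) in
/-- The submodule `RM` of a module `M`. -/
def unitalPart : Submodule (Unitization ℤ R) M where
  carrier := AddSubgroup.closure {x : M | ∃ (r : R) (m : M), x = r ⊳ m}
  add_mem' := add_mem
  zero_mem' := zero_mem _
  smul_mem' c x hx := by
    rw [unitization_smul_eq]
    exact add_mem (zsmul_mem hx _) (AddSubgroup.subset_closure ⟨_, _, rfl⟩)

theorem nuAct_mem_unitalPart (r : R) (m : M) : r ⊳ m ∈ unitalPart R M :=
  AddSubgroup.subset_closure ⟨_, _, rfl⟩

theorem isUnitalModule_iff {R : Type t} [NonUnitalRing R] (M : ModuleCat.{t} (Unitization ℤ R)) :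
    IsUnitalModule R M ↔ unitalPart R M = ⊤ := by
  rw [Submodule.eq_top_iff']
  exact AddSubgroup.eq_top_iff' _

/-- An element of `RM` is a finite sum of terms `± r m`, and a common left unit of the `r` fixes it.
Recording the `r` as a finite set lets a single local unit serve several elements at once. -/
theorem exists_finset_of_mem_unitalPart [DecidableEq R] {m : M} (hm : m ∈ unitalPart R M) :
    ∃ s : Finset R, ∀ e : R, (∀ a ∈ s, e * a = a) → e ⊳ m = m := by
  refine AddSubgroup.closure_induction (p := fun m _ =>
    ∃ s : Finset R, ∀ e : R, (∀ a ∈ s, e * a = a) → e ⊳ m = m) ?_ ?_ ?_ ?_ hm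
  · rintro _ ⟨r, m, rfl⟩
    refine ⟨{r}, fun e he => ?_⟩
    rw [← mul_nuAct, he r (Finset.mem_singleton_self r)]
  · exact ⟨∅, fun e _ => nuAct_zero e⟩
  · rintro x y _ _ ⟨s, hs⟩ ⟨s', hs'⟩
    refine ⟨s ∪ s', fun e he => ?_⟩
    rw [nuAct_add, hs e fun a ha => he a (Finset.mem_union_left _ ha),
      hs' e fun a ha => he a (Finset.mem_union_right _ ha)]
  · rintro x _ ⟨s, hs⟩
    refine ⟨s, fun e he => ?_⟩
    rw [nuAct_neg, hs e he]

/-- In a ring with local units, finitely many ring elements and finitely many elements of `RM`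
have a common unit. -/
theorem HasLocalUnits.exists_unit (hR : HasLocalUnits R) (F : Finset R) (s : Finset M)
    (hs : ∀ m ∈ s, m ∈ unitalPart R M) :
    ∃ e : R, (∀ a ∈ F, e * a = a ∧ a * e = a) ∧ ∀ m ∈ s, e ⊳ m = m := by
  classical
  have : ∀ m : M, ∃ S : Finset R, m ∈ s → ∀ e : R, (∀ a ∈ S, e * a = a) → e ⊳ m = m := by
    intro m
    by_cases hm : m ∈ s
    · obtain ⟨S, hS⟩ := exists_finset_of_mem_unitalPart (hs m hm)
      exact ⟨S, fun _ => hS⟩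
    · exact ⟨∅, fun h => absurd h hm⟩
  choose S hS using this
  obtain ⟨e, he⟩ := hR (F ∪ s.biUnion S)
  refine ⟨e, fun a ha => he a (Finset.mem_union_left _ ha), fun m hm => hS m hm e fun a ha => ?_⟩
  exact (he a (Finset.mem_union_right _ (Finset.mem_biUnion.2 ⟨m, hm, ha⟩))).1

theorem HasLocalUnits.mem_unitalPart_iff (hR : HasLocalUnits R) {m : M} :
    m ∈ unitalPart R M ↔ ∃ e : R, e ⊳ m = m := by
  refine ⟨fun hm => ?_, fun ⟨e, he⟩ => he ▸ nuAct_mem_unitalPart e m⟩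
  obtain ⟨e, -, he⟩ := hR.exists_unit ∅ {m} (by simpa using hm)
  exact ⟨e, he m (by simp)⟩

theorem HasLocalUnits.isUnitalModule_iff {R : Type t} [NonUnitalRing R] (hR : HasLocalUnits R)
    (M : ModuleCat.{t} (Unitization ℤ R)) :
    IsUnitalModule R M ↔ ∀ m : M, ∃ e : R, e ⊳ m = m := by
  rw [_root_.isUnitalModule_iff, Submodule.eq_top_iff']
  exact forall_congr' fun m => hR.mem_unitalPart_iff

theorem UnitalModuleCat.mem_unitalPart {R : Type t} [NonUnitalRing R] (M : UnitalModuleCat R)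
    (m : M.obj) : m ∈ unitalPart R M.obj := by
  rw [(_root_.isUnitalModule_iff M.obj).1 M.property]; trivial

theorem HasLocalUnits.isUnitalModule_of_submodule {R : Type t} [NonUnitalRing R]
    (hR : HasLocalUnits R) {M : Type t} [AddCommGroup M] [Module (Unitization ℤ R) M]
    (N : Submodule (Unitization ℤ R) M) (hN : ∀ m ∈ N, m ∈ unitalPart R M) :
    IsUnitalModule R (ModuleCat.of (Unitization ℤ R) N) := by
  refine (hR.isUnitalModule_iff _).2 fun m => ?_
  obtain ⟨e, he⟩ := hR.mem_unitalPart_iff.1 (hN _ m.2)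
  exact ⟨e, Subtype.ext he⟩

theorem HasLocalUnits.isUnitalModule_of_surjective {R : Type t} [NonUnitalRing R]
    (hR : HasLocalUnits R) (M : UnitalModuleCat R) {N : Type t} [AddCommGroup N]
    [Module (Unitization ℤ R) N] (f : M.obj →ₗ[Unitization ℤ R] N) (hf : Function.Surjective f) :
    IsUnitalModule R (ModuleCat.of (Unitization ℤ R) N) := by
  refine (hR.isUnitalModule_iff _).2 fun n => ?_
  obtain ⟨m, rfl⟩ := hf n
  obtain ⟨e, he⟩ := hR.mem_unitalPart_iff.1 (M.mem_unitalPart m)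
  exact ⟨e, by rw [← map_nuAct f, he]⟩

/-- The restriction of a linear map to the unital parts. -/
def unitalPartMap (f : M →ₗ[Unitization ℤ R] N) :
    unitalPart R M →ₗ[Unitization ℤ R] unitalPart R N :=
  f.restrict fun m hm => by
    refine AddSubgroup.closure_induction (p := fun m _ => f m ∈ unitalPart R N) ?_ ?_ ?_ ?_ hm
    · rintro _ ⟨r, m, rfl⟩
      rw [map_nuAct]; exact nuAct_mem_unitalPart _ _
    · rw [map_zero]; exact zero_mem _
    · intro x y _ _ hx hy
      rw [map_add]; exact add_mem hx hy
    · intro x _ hx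
      rw [map_neg]; exact neg_mem hx

end Basic

/-! ### Restriction of scalars and full corners -/

section Corner

variable {A B : Type*} [NonUnitalRing A] [NonUnitalRing B] (φ : A →ₙ+* B)

/-- The extension of a homomorphism to the unitizations. -/
def unitizationMap : Unitization ℤ A →+* Unitization ℤ B where
  toFun x := Unitization.inl x.fst + Unitization.inr (φ x.snd)
  map_one' := by ext <;> simp
  map_zero' := by ext <;> simp
  map_add' x y := by ext <;> simp
  map_mul' x y := by ext <;> simp [map_zsmul]

theorem unitizationMap_inr (a : A) :
    unitizationMap φ (Unitization.inr a) = Unitization.inr (φ a) := by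
  simp [unitizationMap]

/-- A module over the unitization of `B`, viewed as a module over the unitization of `A`. -/
def RestrictNu (_ : A →ₙ+* B) (M : Type*) : Type _ := M

variable {M N : Type*} [AddCommGroup M] [Module (Unitization ℤ B) M]
  [AddCommGroup N] [Module (Unitization ℤ B) N]

instance : AddCommGroup (RestrictNu φ M) := inferInstanceAs (AddCommGroup M)

instance : Module (Unitization ℤ A) (RestrictNu φ M) := Module.compHom M (unitizationMap φ)

theorem restrictNu_act (a : A) (m : RestrictNu φ M) : a ⊳ m = nuAct (M := M) (φ a) m :=
  congrArg (fun x : Unitization ℤ B => (x • (show M from m) : M)) (unitizationMap_inr φ a)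

/-- Restriction of scalars on morphisms. -/
def restrictNuMap (f : M →ₗ[Unitization ℤ B] N) :
    RestrictNu φ M →ₗ[Unitization ℤ A] RestrictNu φ N where
  toFun := f
  map_add' := f.map_add
  map_smul' x := by
    have h : ∀ m : M, f (unitizationMap φ x • m) = unitizationMap φ x • f m :=
      fun m => f.map_smul _ m
    exact h

variable (M) in
/-- The `A`-submodule `AM` of a `B`-module `M`. -/
abbrev CornerPart : Submodule (Unitization ℤ A) (RestrictNu φ M) :=
  unitalPart A (RestrictNu φ M)

variable {φ}

/-- The inclusion of `AM` in `M`. -/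
def cornerVal : CornerPart φ M →+ M where
  toFun m := m.1
  map_zero' := rfl
  map_add' _ _ := rfl

theorem cornerVal_injective : Function.Injective (cornerVal : CornerPart φ M →+ M) :=
  Subtype.val_injective

@[simp] theorem cornerVal_act (a : A) (m : CornerPart φ M) :
    cornerVal (a ⊳ m) = φ a ⊳ cornerVal m := restrictNu_act φ a _

theorem exists_cornerVal_eq (a : A) (m : M) : ∃ x : CornerPart φ M, cornerVal x = φ a ⊳ m :=
  ⟨⟨a ⊳ (show RestrictNu φ M from m), nuAct_mem_unitalPart _ _⟩, restrictNu_act φ a _⟩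

theorem HasLocalUnits.exists_act_cornerPart (hA : HasLocalUnits A) (m : CornerPart φ M) :
    ∃ a : A, a ⊳ m = m := by
  obtain ⟨a, ha⟩ := hA.mem_unitalPart_iff.1 m.2
  exact ⟨a, Subtype.ext ha⟩

variable (φ) in
/-- The restriction of a `B`-linear map `M → N` to an `A`-linear map `AM → AN`. -/
def cornerMap (f : M →ₗ[Unitization ℤ B] N) :
    CornerPart φ M →ₗ[Unitization ℤ A] CornerPart φ N :=
  unitalPartMap (restrictNuMap φ f)

@[simp] theorem cornerVal_cornerMap (f : M →ₗ[Unitization ℤ B] N) (m : CornerPart φ M) :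
    cornerVal (cornerMap φ f m) = f (cornerVal m) := rfl

end Corner

/-- An embedding of `A` as a full corner of `B`, in the setting of rings with local units:
`A B A = A` and `B A B = B`. -/
structure IsFullCorner {A B : Type*} [NonUnitalRing A] [NonUnitalRing B] (φ : A →ₙ+* B) :
    Prop where
  localUnits : HasLocalUnits A
  localUnits' : HasLocalUnits B
  injective : Function.Injective φ
  corner : ∀ a b a', ∃ c, φ c = φ a * b * φ a'
  full : ∀ b, b ∈ AddSubgroup.closure {x | ∃ b₁ a b₂, x = b₁ * φ a * b₂}

section CornerFunctor

variable {A B : Type t} [NonUnitalRing A] [NonUnitalRing B] {φ : A →ₙ+* B} (hφ : IsFullCorner φ)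

/-- The functor `M ↦ AM`. -/
def cornerFunctor : UnitalModuleCat B ⥤ UnitalModuleCat A where
  obj M := ⟨ModuleCat.of _ (CornerPart φ M.obj),
    hφ.localUnits.isUnitalModule_of_submodule _ fun _ h => h⟩
  map f := ObjectProperty.homMk (ModuleCat.ofHom (cornerMap φ f.hom.hom))

/-- `M = B(AM)` for every unital module `M`. -/
theorem IsFullCorner.induction (hφ : IsFullCorner φ) {M : Type*} [AddCommGroup M]
    [Module (Unitization ℤ B) M] {p : M → Prop}
    (h : ∀ (b : B) (a : A) (m : M), p (b ⊳ φ a ⊳ m)) (h0 : p 0)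
    (hadd : ∀ x y, p x → p y → p (x + y)) (hneg : ∀ x, p x → p (-x))
    {m : M} (hm : m ∈ unitalPart B M) : p m := by
  obtain ⟨e, he⟩ := hφ.localUnits'.mem_unitalPart_iff.1 hm
  rw [← he]
  refine AddSubgroup.closure_induction (p := fun b _ => p (b ⊳ m)) ?_ ?_ ?_ ?_ (hφ.full e)
  · rintro _ ⟨b, a, c, rfl⟩
    rw [mul_nuAct, mul_nuAct]; exact h _ _ _
  · rw [zero_nuAct]; exact h0
  · intro x y _ _ hx hy
    rw [add_nuAct]; exact hadd _ _ hx hy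
  · intro x _ hx
    rw [neg_nuAct]; exact hneg _ hx

/-- An element of a unital module that is killed by `AB` is zero. -/
theorem IsFullCorner.eq_zero (hφ : IsFullCorner φ) {M : Type*} [AddCommGroup M]
    [Module (Unitization ℤ B) M] {m : M} (hm : m ∈ unitalPart B M)
    (h : ∀ (a : A) (b : B), φ a ⊳ b ⊳ m = 0) : m = 0 := by
  obtain ⟨e, he⟩ := hφ.localUnits'.mem_unitalPart_iff.1 hm
  rw [← he]
  refine AddSubgroup.closure_induction (p := fun b _ => b ⊳ m = 0) ?_ ?_ ?_ ?_ (hφ.full e)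
  · rintro _ ⟨b, a, c, rfl⟩
    rw [mul_nuAct, mul_nuAct, h, nuAct_zero]
  · exact zero_nuAct m
  · intro x y _ _ hx hy
    rw [add_nuAct, hx, hy, add_zero]
  · intro x _ hx
    rw [neg_nuAct, hx, neg_zero]

/-- A morphism is determined on `AM`, hence on `B(AM) = M`. -/
theorem cornerFunctor_faithful : (cornerFunctor hφ).Faithful where
  map_injective {M N} f g hfg := by
    ext m
    have key : ∀ m : CornerPart φ M.obj,
        f.hom.hom (cornerVal m) = g.hom.hom (cornerVal m) := fun m =>
      congrArg cornerVal (congrArg (fun k => (k.hom.hom : CornerPart φ M.obj →ₗ[Unitization ℤ A]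
        CornerPart φ N.obj) m) hfg)
    refine hφ.induction (p := fun m => f.hom.hom m = g.hom.hom m) ?_ ?_ ?_ ?_
      (M.mem_unitalPart m)
    · intro b a m
      obtain ⟨x, hx⟩ := exists_cornerVal_eq (φ := φ) a m
      rw [map_nuAct f.hom.hom b, map_nuAct g.hom.hom b, ← hx, key]
    · rw [map_zero, map_zero]
    · intro x y hx hy
      rw [map_add, map_add, hx, hy]
    · intro x hx
      rw [map_neg, map_neg, hx]

end CornerFunctor

end UnitalModules

/-! ### Fullness and essential surjectivity of the corner functor -/

section FullCorner

attribute [-instance] Unitization.instNonAssocSemiring Unitization.instNonAssocRing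
  Unitization.instSemiring Unitization.instMonoid Unitization.instMulOneClass

local infixr:73 " ⊳ " => nuAct

variable {A B : Type t} [NonUnitalRing A] [NonUnitalRing B] {φ : A →ₙ+* B}

/-- `R` is an ideal of its unitization, so `r x` is again an element of `R`. -/
theorem nuAct_smul {R M : Type*} [NonUnitalRing R] [AddCommGroup M] [Module (Unitization ℤ R) M]
    (r : R) (x : Unitization ℤ R) (m : M) : r ⊳ (x • m) = (x.fst • r + r * x.snd) ⊳ m := by
  have : (Unitization.inr r : Unitization ℤ R) * x = Unitization.inr (x.fst • r + r * x.snd) := by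
    ext <;> simp
  rw [nuAct, nuAct, ← this]
  exact (mul_smul (Unitization.inr r : Unitization ℤ R) x m).symm

theorem unitization_mul_assoc {R : Type*} [NonUnitalRing R] (x y z : Unitization ℤ R) :
    x * y * z = x * (y * z) := mul_assoc x y z

/-- The extension is built as a graph: `Γ` is the `B`-submodule of `M × N` generated by the pairs
`(m, g m)` with `m` in `AM`. Multiplying `Γ` by `AB` leads back into the graph of `g`. Hence if the
first component of an element of `Γ` is zero, then `AB` kills the second, which must vanish. So `Γ`
projects injectively to `M`, and surjectively because `M = B(AM)`. -/
theorem IsFullCorner.exists_extension (hφ : IsFullCorner φ) {M N : Type*}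
    [AddCommGroup M] [Module (Unitization ℤ B) M] [AddCommGroup N] [Module (Unitization ℤ B) N]
    (hM : ∀ m : M, m ∈ unitalPart B M) (hN : ∀ n : N, n ∈ unitalPart B N)
    (g : CornerPart φ M →ₗ[Unitization ℤ A] CornerPart φ N) :
    ∃ h : M →ₗ[Unitization ℤ B] N, cornerMap φ h = g := by
  let Γ : Submodule (Unitization ℤ B) (M × N) :=
    Submodule.span _ {p | ∃ m : CornerPart φ M, p = (cornerVal m, cornerVal (g m))}
  have hΓ : ∀ p ∈ Γ, ∀ (a : A) (b : B), ∃ m : CornerPart φ M,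
      cornerVal m = φ a ⊳ b ⊳ p.1 ∧ cornerVal (g m) = φ a ⊳ b ⊳ p.2 := by
    intro p hp
    refine Submodule.span_induction (p := fun p _ => ∀ (a : A) (b : B), ∃ m : CornerPart φ M,
      cornerVal m = φ a ⊳ b ⊳ p.1 ∧ cornerVal (g m) = φ a ⊳ b ⊳ p.2) ?_ ?_ ?_ ?_ hp
    · rintro _ ⟨m, rfl⟩ a b
      -- With `e m = m`, the element `a b m` equals `(a b e) m`, where `a b e` lies in `A` and so
      -- commutes with `g`.
      obtain ⟨e, he⟩ := hφ.localUnits.exists_act_cornerPart m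
      obtain ⟨c, hc⟩ := hφ.corner a b e
      refine ⟨c ⊳ m, ?_, ?_⟩
      · conv_rhs => rw [← he]
        rw [cornerVal_act, cornerVal_act, hc, mul_nuAct, mul_nuAct]
      · have h2 := map_nuAct g e m
        rw [he] at h2
        change _ = φ a ⊳ b ⊳ cornerVal (g m)
        conv_rhs => rw [h2]
        rw [map_nuAct, cornerVal_act, cornerVal_act, hc, mul_nuAct, mul_nuAct]
    · intro a b
      exact ⟨0, by simp, by simp⟩
    · intro x y _ _ hx hy a b
      obtain ⟨m, h1, h2⟩ := hx a b
      obtain ⟨m', h1', h2'⟩ := hy a b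
      refine ⟨m + m', ?_, ?_⟩
      · rw [Prod.fst_add, nuAct_add, nuAct_add, ← h1, ← h1', map_add]
      · rw [Prod.snd_add, nuAct_add, nuAct_add, ← h2, ← h2', map_add, map_add]
    · intro c x _ hx a b
      obtain ⟨m, h1, h2⟩ := hx a (c.fst • b + b * c.snd)
      refine ⟨m, ?_, ?_⟩
      · rw [Prod.smul_fst, nuAct_smul, h1]
      · rw [Prod.smul_snd, nuAct_smul, h2]
  let π : Γ →ₗ[Unitization ℤ B] M := (LinearMap.fst _ M N).comp Γ.subtype
  have hinj : Function.Injective π := by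
    refine (injective_iff_map_eq_zero π).2 fun p hp => ?_
    have hp1 : (p : M × N).1 = 0 := hp
    refine Subtype.ext (Prod.ext hp1 (hφ.eq_zero (hN _) fun a b => ?_))
    obtain ⟨m, h1, h2⟩ := hΓ p p.2 a b
    rw [hp1, nuAct_zero, nuAct_zero] at h1
    have : m = 0 := cornerVal_injective (h1.trans (map_zero _).symm)
    rw [← h2, this, map_zero, map_zero]
  have hsurj : Function.Surjective π := by
    intro m
    refine hφ.induction (p := fun m => ∃ x, π x = m) ?_ ⟨0, map_zero _⟩ ?_ ?_ (hM m)
    · intro b a m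
      obtain ⟨z, hz⟩ := exists_cornerVal_eq (φ := φ) a m
      refine ⟨b ⊳ ⟨(cornerVal z, cornerVal (g z)), Submodule.subset_span ⟨z, rfl⟩⟩, ?_⟩
      rw [map_nuAct, ← hz]; rfl
    · rintro x y ⟨x, rfl⟩ ⟨y, rfl⟩
      exact ⟨x + y, map_add _ _ _⟩
    · rintro x ⟨x, rfl⟩
      exact ⟨-x, map_neg _ _⟩
  let ε := LinearEquiv.ofBijective π ⟨hinj, hsurj⟩
  refine ⟨((LinearMap.snd _ M N).comp Γ.subtype).comp ε.symm.toLinearMap, ?_⟩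
  refine LinearMap.ext fun m => cornerVal_injective ?_
  have : ε.symm (cornerVal m) = ⟨(cornerVal m, cornerVal (g m)),
      Submodule.subset_span ⟨m, rfl⟩⟩ := by
    rw [LinearEquiv.symm_apply_eq]; rfl
  rw [cornerVal_cornerMap]
  change ((ε.symm (cornerVal m) : Γ) : M × N).2 = _
  rw [this]

theorem cornerFunctor_full (hφ : IsFullCorner φ) : (cornerFunctor hφ).Full where
  map_surjective {M N} g := by
    obtain ⟨h, hh⟩ := hφ.exists_extension M.mem_unitalPart N.mem_unitalPart g.hom.hom
    refine ⟨ObjectProperty.homMk (ModuleCat.ofHom h), ?_⟩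
    ext1
    exact ModuleCat.hom_ext hh

/-! The module `Hom_A(AB, N)` -/

variable (φ) in
/-- The left `A`- and right `B`-module `AB`. -/
abbrev LeftCorner : Submodule (Unitization ℤ A) (RestrictNu φ (Unitization ℤ B)) :=
  CornerPart φ (Unitization ℤ B)

variable (φ) in
/-- The right action of `B` on `AB`. -/
def LeftCorner.mulRight (c : Unitization ℤ B) :
    LeftCorner φ →ₗ[Unitization ℤ A] LeftCorner φ :=
  cornerMap φ (LinearMap.toSpanSingleton (Unitization ℤ B) (Unitization ℤ B) c)

theorem LeftCorner.mulRight_coe (c : Unitization ℤ B) (p : LeftCorner φ) :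
    cornerVal (LeftCorner.mulRight φ c p) = cornerVal p * c := rfl

variable (φ) in
/-- The `B`-module `Hom_A(AB, N)`. -/
def CoindNu (N : Type*) [AddCommGroup N] [Module (Unitization ℤ A) N] : Type _ :=
  LeftCorner φ →ₗ[Unitization ℤ A] N

section Coind

variable {N : Type t} [AddCommGroup N] [Module (Unitization ℤ A) N]

instance : AddCommGroup (CoindNu φ N) :=
  inferInstanceAs (AddCommGroup (LeftCorner φ →ₗ[Unitization ℤ A] N))

/-- An element of `Hom_A(AB, N)` as a linear map. -/
def CoindNu.toLin (g : CoindNu φ N) : LeftCorner φ →ₗ[Unitization ℤ A] N := g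

theorem CoindNu.ext {g h : CoindNu φ N} (H : ∀ p, g.toLin p = h.toLin p) : g = h :=
  LinearMap.ext H

instance : Module (Unitization ℤ B) (CoindNu φ N) where
  smul c g := g.toLin.comp (LeftCorner.mulRight φ c)
  one_smul g := CoindNu.ext fun p =>
    congrArg g.toLin (cornerVal_injective (mul_one (cornerVal p)))
  mul_smul c d g := CoindNu.ext fun p =>
    congrArg g.toLin (cornerVal_injective (mul_assoc (cornerVal p) c d).symm)
  smul_zero _ := rfl
  smul_add _ _ _ := rfl
  add_smul c d g := CoindNu.ext fun p =>
    (congrArg g.toLin (cornerVal_injective (Distrib.left_distrib (cornerVal p) c d))).trans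
      (g.toLin.map_add (LeftCorner.mulRight φ c p) (LeftCorner.mulRight φ d p))
  zero_smul g := CoindNu.ext fun p =>
    (congrArg g.toLin (cornerVal_injective (mul_zero (cornerVal p)))).trans
      (g.toLin.map_zero)

theorem CoindNu.act_apply (b : B) (g : CoindNu φ N) (p : LeftCorner φ) :
    (b ⊳ g).toLin p = g.toLin (LeftCorner.mulRight φ (Unitization.inr b) p) := rfl

/-- As `p = a p` and `e = e e'` for suitable `a` and `e'` in `A`, the product `p e = a (p e) e'`
lies in `ABA = A`. This gives a pairing of `AB` with a unital `A`-module: `(p, n) ↦ (p e) n`, where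
`e n = n`. -/
theorem IsFullCorner.exists_mul_eq (hφ : IsFullCorner φ) (p : LeftCorner φ) (e : A) :
    ∃ c : A, (Unitization.inr (φ c) : Unitization ℤ B) = cornerVal p * Unitization.inr (φ e) := by
  obtain ⟨a, ha⟩ := hφ.localUnits.exists_act_cornerPart p
  obtain ⟨e', he'⟩ := hφ.localUnits {e}
  have he := (he' e (by simp)).2
  set x : Unitization ℤ B := cornerVal p with hx
  obtain ⟨c, hc⟩ := hφ.corner a (x.fst • φ e + x.snd * φ e) e'
  refine ⟨c, ?_⟩
  have h1 : x * Unitization.inr (φ e) = Unitization.inr (x.fst • φ e + x.snd * φ e) := by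
    ext <;> simp
  have h2 : Unitization.inr (φ a) * x = x := by
    conv_rhs => rw [hx, ← ha]
    exact (cornerVal_act a p).symm
  have h3 : (x.fst • φ e + x.snd * φ e) * φ e' = x.fst • φ e + x.snd * φ e := by
    rw [add_mul, smul_mul_assoc, mul_assoc, ← map_mul, he]
  rw [hc, mul_assoc, h3, Unitization.inr_mul, ← h1, ← unitization_mul_assoc, h2]

/-- The pairing is independent of the unit chosen for `n`: if `f` is a common unit of `e` and `e'`,
then `p e = (p f) e`, so `(p e) n = (p f) n`, and likewise for `e'`. -/
theorem IsFullCorner.act_unique (hφ : IsFullCorner φ) (p : LeftCorner φ) (n : N) {e e' c c' : A}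
    (he : e ⊳ n = n) (he' : e' ⊳ n = n)
    (hc : (Unitization.inr (φ c) : Unitization ℤ B) = cornerVal p * Unitization.inr (φ e))
    (hc' : (Unitization.inr (φ c') : Unitization ℤ B) = cornerVal p * Unitization.inr (φ e')) :
    c ⊳ n = c' ⊳ n := by
  classical
  obtain ⟨f, hf⟩ := hφ.localUnits {e, e'}
  obtain ⟨d, hd⟩ := hφ.exists_mul_eq p f
  have key : ∀ e c : A, e ⊳ n = n → f * e = e →
      (Unitization.inr (φ c) : Unitization ℤ B) = cornerVal p * Unitization.inr (φ e) →
      c ⊳ n = d ⊳ n := by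
    intro e c he hfe hc
    have : c = d * e := by
      apply hφ.injective
      apply Unitization.inr_injective (R := ℤ)
      rw [hc, map_mul, Unitization.inr_mul, hd, unitization_mul_assoc, ← Unitization.inr_mul, ← map_mul, hfe]
    rw [this, mul_nuAct, he]
  rw [key e c he (hf e (by simp)).1 hc, key e' c' he' (hf e' (by simp)).1 hc']

/-- Every unital `A`-module `N` is the corner part of a module over `B`. -/
theorem IsFullCorner.exists_coind (hφ : IsFullCorner φ) (hN : ∀ n : N, n ∈ unitalPart A N) :
    ∃ η : N →+ CoindNu φ N, (∀ (a : A) n, η (a ⊳ n) = φ a ⊳ η n) ∧ Function.Injective η ∧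
      ∀ (a : A) g, φ a ⊳ g = g → ∃ n, η n = g := by
  -- The value of `η n` at `p` is to be `(p e) n` for any `e` with `e n = n`. Characterizing it for
  -- all such `e` at once lets each identity below be checked with a convenient unit.
  have hF : ∀ (n : N) (p : LeftCorner φ), ∃ z : N, ∀ e c : A, e ⊳ n = n →
      (Unitization.inr (φ c) : Unitization ℤ B) = cornerVal p * Unitization.inr (φ e) →
      c ⊳ n = z := by
    intro n p
    obtain ⟨e, he⟩ := hφ.localUnits.mem_unitalPart_iff.1 (hN n)
    obtain ⟨c, hc⟩ := hφ.exists_mul_eq p e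
    exact ⟨c ⊳ n, fun e' c' he' hc' => hφ.act_unique p n he' he hc' hc⟩
  choose F hF using hF
  have hF_add : ∀ n p q, F n (p + q) = F n p + F n q := by
    intro n p q
    obtain ⟨e, he⟩ := hφ.localUnits.mem_unitalPart_iff.1 (hN n)
    obtain ⟨c, hc⟩ := hφ.exists_mul_eq p e
    obtain ⟨d, hd⟩ := hφ.exists_mul_eq q e
    rw [← hF n p e c he hc, ← hF n q e d he hd, ← add_nuAct, hF n (p + q) e (c + d) he]
    rw [map_add, Unitization.inr_add, hc, hd, map_add]
    exact (Distrib.right_distrib (cornerVal p) (cornerVal q)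
      (Unitization.inr (φ e) : Unitization ℤ B)).symm
  have hF_act : ∀ n (a : A) p, F n (a ⊳ p) = a ⊳ F n p := by
    intro n a p
    obtain ⟨e, he⟩ := hφ.localUnits.mem_unitalPart_iff.1 (hN n)
    obtain ⟨c, hc⟩ := hφ.exists_mul_eq p e
    rw [← hF n p e c he hc, ← mul_nuAct, hF n (a ⊳ p) e (a * c) he]
    rw [map_mul, Unitization.inr_mul, hc, ← unitization_mul_assoc, cornerVal_act]; rfl
  have hF_add' : ∀ n m p, F (n + m) p = F n p + F m p := by
    classical
    intro n m p
    obtain ⟨e, -, he⟩ := hφ.localUnits.exists_unit ∅ {n, m} (fun x _ => hN x)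
    have hn := he n (by simp)
    have hm := he m (by simp)
    obtain ⟨c, hc⟩ := hφ.exists_mul_eq p e
    rw [← hF n p e c hn hc, ← hF m p e c hm hc, ← nuAct_add,
      hF (n + m) p e c (by rw [nuAct_add, hn, hm]) hc]
  have hF_act' : ∀ n (a : A) p,
      F (a ⊳ n) p = F n (LeftCorner.mulRight φ (Unitization.inr (φ a)) p) := by
    intro n a p
    obtain ⟨e, he, he'⟩ := hφ.localUnits.exists_unit {a} {n} (fun x _ => hN x)
    have ha := he a (by simp)
    obtain ⟨c, hc⟩ := hφ.exists_mul_eq p e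
    rw [← hF (a ⊳ n) p e c (by rw [← mul_nuAct, ha.1]) hc, ← mul_nuAct,
      ← hF n _ e (c * a) (he' n (by simp))]
    rw [LeftCorner.mulRight_coe, unitization_mul_assoc, ← Unitization.inr_mul, ← map_mul, ha.2, map_mul,
      Unitization.inr_mul, hc, unitization_mul_assoc, ← Unitization.inr_mul, ← map_mul, ha.1]
  let G : N → CoindNu φ N := fun n =>
    linearMapOfNuAct (AddMonoidHom.mk' (F n) (hF_add n)) (fun a p => hF_act n a p)
  have hG : ∀ n p, (G n).toLin p = F n p := fun n p => rfl
  refine ⟨AddMonoidHom.mk' G fun n m => CoindNu.ext fun p => hF_add' n m p,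
    fun a n => CoindNu.ext fun p => hF_act' n a p, ?_, ?_⟩
  -- Evaluating `η n` at the element `e e` of `AB` recovers `n`.
  · refine (injective_iff_map_eq_zero _).2 fun n hn => ?_
    obtain ⟨e, he⟩ := hφ.localUnits.mem_unitalPart_iff.1 (hN n)
    obtain ⟨p, hp⟩ := exists_cornerVal_eq (φ := φ) e (Unitization.inr (φ e) : Unitization ℤ B)
    have h1 : F n p = 0 := (hG n p).symm.trans (congrArg (fun g : CoindNu φ N => g.toLin p) hn)
    obtain ⟨c, hc⟩ := hφ.exists_mul_eq p e
    have : c = e * e * e := by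
      apply hφ.injective
      apply Unitization.inr_injective (R := ℤ)
      rw [hc, hp, map_mul, map_mul, Unitization.inr_mul, Unitization.inr_mul]; rfl
    rw [← hF n p e c he hc, this, mul_nuAct, mul_nuAct, he, he, he] at h1
    exact h1
  -- If `a g = g`, then `g = η (g q)` for `q = a` viewed in `AB`: one has `(p e) g(q) = g(p e a) =
  -- g(p a) = (a g)(p) = g(p)`, where `e` is a unit for both `a` and `g q`.
  · intro a g hg
    obtain ⟨f, hf⟩ := hφ.localUnits {a}
    obtain ⟨q, hq⟩ := exists_cornerVal_eq (φ := φ) f (Unitization.inr (φ a) : Unitization ℤ B)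
    have hq' : cornerVal q = (Unitization.inr (φ a) : Unitization ℤ B) := by
      rw [hq]
      change (Unitization.inr (φ f) : Unitization ℤ B) * Unitization.inr (φ a) = _
      rw [← Unitization.inr_mul, ← map_mul, (hf a (by simp)).1]
    refine ⟨g.toLin q, CoindNu.ext fun p => ?_⟩
    change F (g.toLin q) p = _
    obtain ⟨e, he, he'⟩ := hφ.localUnits.exists_unit {a} {g.toLin q} (fun x _ => hN x)
    obtain ⟨c, hc⟩ := hφ.exists_mul_eq p e
    rw [← hF _ p e c (he' _ (by simp)) hc, ← map_nuAct]
    conv_rhs => rw [← hg]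
    rw [CoindNu.act_apply]
    refine congrArg g.toLin (cornerVal_injective ?_)
    rw [cornerVal_act, LeftCorner.mulRight_coe, hq']
    change (Unitization.inr (φ c) : Unitization ℤ B) * Unitization.inr (φ a) = _
    rw [hc, unitization_mul_assoc, ← Unitization.inr_mul, ← map_mul, (he a (by simp)).1]

end Coind

/-- The preimage of `N` is `Q = B Hom_A(AB, N)`. The map `η` takes values in `Q`, since each `η n`
is fixed by some element of `A`, and its image is all of `AQ`, since every element of `AQ` is fixed
by some element of `A`. -/
theorem cornerFunctor_essSurj (hφ : IsFullCorner φ) : (cornerFunctor hφ).EssSurj where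
  mem_essImage N := by
    obtain ⟨η, hη_act, hη_inj, hη_surj⟩ := hφ.exists_coind N.mem_unitalPart
    let Q : UnitalModuleCat B := ⟨ModuleCat.of _ (unitalPart B (CoindNu φ N.obj)),
      hφ.localUnits'.isUnitalModule_of_submodule _ fun _ h => h⟩
    have hmem : ∀ n : N.obj, ∃ a : A, φ a ⊳ η n = η n := by
      intro n
      obtain ⟨a, ha⟩ := hφ.localUnits.mem_unitalPart_iff.1 (N.mem_unitalPart n)
      exact ⟨a, by rw [← hη_act, ha]⟩
    have hval : ∀ n : N.obj, ∃ z : CornerPart φ Q.obj,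
        (unitalPart B (CoindNu φ N.obj)).subtype (cornerVal z) = η n := by
      intro n
      obtain ⟨a, ha⟩ := hmem n
      have hB : η n ∈ unitalPart B (CoindNu φ N.obj) := ha ▸ nuAct_mem_unitalPart _ _
      obtain ⟨z, hz⟩ := exists_cornerVal_eq (φ := φ) a (⟨η n, hB⟩ : Q.obj)
      refine ⟨z, ?_⟩
      rw [hz]
      exact ha
    choose ζ hζ using hval
    have hinj : Function.Injective fun z : CornerPart φ Q.obj =>
        (unitalPart B (CoindNu φ N.obj)).subtype (cornerVal z) :=
      Subtype.val_injective.comp cornerVal_injective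
    let ζ' : N.obj →ₗ[Unitization ℤ A] CornerPart φ Q.obj :=
      linearMapOfNuAct (AddMonoidHom.mk' ζ fun n m => hinj (by
        simp only [map_add, hζ])) fun a n => hinj (by
          change (unitalPart B (CoindNu φ N.obj)).subtype (cornerVal (ζ (a ⊳ n))) =
            (unitalPart B (CoindNu φ N.obj)).subtype (cornerVal (a ⊳ ζ n))
          rw [hζ, cornerVal_act, hη_act, ← hζ n]
          rfl)
    have hbij : Function.Bijective ζ' := by
      constructor
      · intro n m h
        apply hη_inj
        rw [← hζ, ← hζ]
        exact congrArg (fun z => (unitalPart B (CoindNu φ N.obj)).subtype (cornerVal z)) h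
      · intro z
        obtain ⟨a, ha⟩ := hφ.localUnits.exists_act_cornerPart z
        obtain ⟨n, hn⟩ := hη_surj a ((unitalPart B (CoindNu φ N.obj)).subtype (cornerVal z)) (by
          have h1 : φ a ⊳ cornerVal z = cornerVal z := by rw [← cornerVal_act, ha]
          exact congrArg (unitalPart B (CoindNu φ N.obj)).subtype h1)
        exact ⟨n, hinj ((hζ n).trans hn)⟩
    exact ⟨Q, ⟨ObjectProperty.isoMk _ (LinearEquiv.ofBijective ζ' hbij).symm.toModuleIso⟩⟩

/-- A full corner embedding of rings with local units is a Morita equivalence. -/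
theorem IsFullCorner.moritaEquivalent (hφ : IsFullCorner φ) : MoritaEquivalentRings A B := by
  have := cornerFunctor_faithful hφ
  have := cornerFunctor_full hφ
  have := cornerFunctor_essSurj hφ
  have : (cornerFunctor hφ).IsEquivalence := {}
  exact ⟨(cornerFunctor hφ).asEquivalence.symm⟩

end FullCorner

/-! ### Finite generation under equivalences of module categories -/

section FinitelyGenerated

attribute [-instance] Unitization.instNonAssocSemiring Unitization.instNonAssocRing
  Unitization.instSemiring Unitization.instMonoid Unitization.instMulOneClass

variable {R S : Type t} [NonUnitalRing R] [NonUnitalRing S]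

/-- A submodule of a unital module, as an object of the category of unital modules. -/
def HasLocalUnits.sub (hR : HasLocalUnits R) (X : UnitalModuleCat R)
    (N : Submodule (Unitization ℤ R) X.obj) : UnitalModuleCat R :=
  ⟨ModuleCat.of _ N, hR.isUnitalModule_of_submodule N fun m _ => X.mem_unitalPart m⟩

/-- The inclusion of a submodule of a unital module. -/
def HasLocalUnits.subι (hR : HasLocalUnits R) (X : UnitalModuleCat R)
    (N : Submodule (Unitization ℤ R) X.obj) : hR.sub X N ⟶ X :=
  ObjectProperty.homMk (ModuleCat.ofHom N.subtype)

/-- A quotient of a unital module, as an object of the category of unital modules. -/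
def HasLocalUnits.quot (hR : HasLocalUnits R) (X : UnitalModuleCat R)
    (N : Submodule (Unitization ℤ R) X.obj) : UnitalModuleCat R :=
  ⟨ModuleCat.of _ (X.obj ⧸ N), hR.isUnitalModule_of_surjective X N.mkQ N.mkQ_surjective⟩

/-- The projection of a unital module to a quotient. -/
def HasLocalUnits.quotπ (hR : HasLocalUnits R) (X : UnitalModuleCat R)
    (N : Submodule (Unitization ℤ R) X.obj) : X ⟶ hR.quot X N :=
  ObjectProperty.homMk (ModuleCat.ofHom N.mkQ)

theorem UnitalModuleCat.hom_ext_apply {X Y : UnitalModuleCat R} {f g : X ⟶ Y}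
    (h : ∀ x : X.obj, f.hom.hom x = g.hom.hom x) : f = g := by
  ext1
  exact ModuleCat.hom_ext (LinearMap.ext h)

/-- Equality with the zero map to the quotient by `N` characterizes `N = ⊤`. -/
theorem HasLocalUnits.eq_top_of_quot (hR : HasLocalUnits R) (X : UnitalModuleCat R)
    (N : Submodule (Unitization ℤ R) X.obj)
    (h : hR.quotπ X N = ObjectProperty.homMk (ModuleCat.ofHom 0)) : N = ⊤ := by
  rw [Submodule.eq_top_iff']
  intro x
  have : N.mkQ x = 0 := congrArg (fun f => f.hom.hom x) h
  simpa using this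

/-- An equivalence of categories of unital modules sends cyclic modules to finitely generated
modules. -/
theorem exists_finset_span_eq_top (hR : HasLocalUnits R) (hS : HasLocalUnits S)
    (Φ : UnitalModuleCat R ≌ UnitalModuleCat S) (X : UnitalModuleCat R) (x : X.obj)
    (hx : Submodule.span (Unitization ℤ R) {x} = ⊤) :
    ∃ s : Finset (Φ.functor.obj X).obj,
      Submodule.span (Unitization ℤ S) (s : Set (Φ.functor.obj X).obj) = ⊤ := by
  classical
  -- Finite generation is detected by directed families of subobjects. The finitely generated
  -- submodules `N s` of `Q` are sent back by the inverse functor to maps `j s` into `X`. Their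
  -- images `V s` are directed with supremum `X`, so the generator `x` lies in one of them, and for
  -- that `s` also `N s = Q`.
  let Q := Φ.functor.obj X
  let N : Finset Q.obj → Submodule (Unitization ℤ S) Q.obj := fun s =>
    Submodule.span _ (s : Set Q.obj)
  let i : ∀ s, hS.sub Q (N s) ⟶ Q := fun s => hS.subι Q (N s)
  let j : ∀ s, Φ.inverse.obj (hS.sub Q (N s)) ⟶ X :=
    fun s => Φ.inverse.map (i s) ≫ Φ.unitInv.app X
  have hij : ∀ s, Φ.inverse.map (i s) = j s ≫ Φ.unit.app X := fun s => by
    simp only [j, Category.assoc, Equivalence.unitIso_inv_hom_id_app]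
    exact (Category.comp_id (Φ.inverse.map (i s))).symm
  have key : ∀ {Y : UnitalModuleCat R} (f g : X ⟶ Y) (s), j s ≫ f = j s ≫ g →
      i s ≫ Φ.functor.map f = i s ≫ Φ.functor.map g := by
    intro Y f g s h
    apply Φ.inverse.map_injective
    simp only [Functor.map_comp, Equivalence.inv_fun_map]
    have := congrArg (· ≫ Φ.unit.app Y) h
    simpa [j] using this
  let V : Finset Q.obj → Submodule (Unitization ℤ R) X.obj := fun s => LinearMap.range (j s).hom.hom
  -- The projection from `X` to the quotient by all the `V s` kills every `j s`. Its image under the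
  -- functor therefore kills every `N {q}`, that is, every element of `Q`.
  have hV : ⨆ s, V s = ⊤ := by
    apply hR.eq_top_of_quot
    apply Φ.functor.map_injective
    refine UnitalModuleCat.hom_ext_apply fun q => ?_
    have h1 := key (hR.quotπ X (⨆ s, V s)) (ObjectProperty.homMk (ModuleCat.ofHom 0)) {q} (by
      refine UnitalModuleCat.hom_ext_apply fun z => ?_
      change (⨆ s, V s).mkQ ((j {q}).hom.hom z) = 0
      rw [Submodule.mkQ_apply, Submodule.Quotient.mk_eq_zero]
      exact Submodule.mem_iSup_of_mem {q} ⟨z, rfl⟩)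
    have hq : q ∈ N {q} := Submodule.subset_span (by simp)
    exact congrArg (fun f => f.hom.hom (⟨q, hq⟩ : N {q})) h1
  have hmono : Monotone V := by
    intro s s' hs
    have hN : N s ≤ N s' := Submodule.span_mono (by exact_mod_cast hs)
    let k : hS.sub Q (N s) ⟶ hS.sub Q (N s') :=
      ObjectProperty.homMk (ModuleCat.ofHom (Submodule.inclusion hN))
    have hk : i s = k ≫ i s' := rfl
    rintro _ ⟨z, rfl⟩
    refine ⟨(Φ.inverse.map k).hom.hom z, ?_⟩
    have : j s = Φ.inverse.map k ≫ j s' := by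
      simp only [j, hk, Functor.map_comp, Category.assoc]
    rw [this]; rfl
  have hxV : x ∈ ⨆ s, V s := hV ▸ Submodule.mem_top
  obtain ⟨s, hs⟩ := (Submodule.mem_iSup_of_directed V hmono.directed_le).1 hxV
  refine ⟨s, ?_⟩
  have hsurj : V s = ⊤ := by
    rw [eq_top_iff, ← hx, Submodule.span_le]
    simpa using hs
  -- Now `j s` is surjective, hence can be cancelled. So the image under the inverse functor of the
  -- projection from `Q` to `Q / N s` vanishes, and with it the projection.
  have hepi : ∀ {Y : UnitalModuleCat R} (f g : X ⟶ Y), j s ≫ f = j s ≫ g → f = g := by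
    intro Y f g h
    refine UnitalModuleCat.hom_ext_apply fun y => ?_
    obtain ⟨z, rfl⟩ : y ∈ V s := hsurj ▸ Submodule.mem_top
    exact congrArg (fun f => f.hom.hom z) h
  apply hS.eq_top_of_quot
  apply Φ.inverse.map_injective
  have h2 : i s ≫ hS.quotπ Q (N s) = i s ≫ ObjectProperty.homMk (ModuleCat.ofHom 0) := by
    refine UnitalModuleCat.hom_ext_apply fun z => ?_
    change (N s).mkQ (z : N s).1 = 0
    rw [Submodule.mkQ_apply, Submodule.Quotient.mk_eq_zero]
    exact (z : N s).2
  have h3 := congrArg (fun f => Φ.inverse.map f) h2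
  simp only [Functor.map_comp, hij, Category.assoc] at h3
  have h4 := hepi _ _ h3
  exact (cancel_epi (Φ.unit.app X)).1 h4

end FinitelyGenerated

namespace DirectedGraph

/-! ### Families satisfying the Leavitt relations -/

section Families

/-- A family of elements of a ring that satisfies the defining relations of the Leavitt path
algebra. -/
structure LeavittFamily (E : DirectedGraph.{u}) (R : Type*) [Ring R] where
  vert : E.Vertex → R
  edge : E.Edge → R
  ghost : E.Edge → R
  vert_mul_self : ∀ v, vert v * vert v = vert v
  vert_mul_of_ne : ∀ v v', v ≠ v' → vert v * vert v' = 0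
  source_mul_edge : ∀ e, vert (E.source e) * edge e = edge e
  edge_mul_range : ∀ e, edge e * vert (E.range e) = edge e
  range_mul_ghost : ∀ e, vert (E.range e) * ghost e = ghost e
  ghost_mul_source : ∀ e, ghost e * vert (E.source e) = ghost e
  ghost_mul_self : ∀ e, ghost e * edge e = vert (E.range e)
  ghost_mul_of_ne : ∀ e f, e ≠ f → ghost e * edge f = 0
  vert_eq_sum : ∀ v (h : E.IsRegular v), vert v = ∑ e ∈ h.2.toFinset, edge e * ghost e

variable {E : DirectedGraph.{u}} {R : Type*} [Ring R]

/-- The image of a generator in a family. -/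
def LeavittFamily.gen (F : LeavittFamily E R) : E.Generator → R
  | .vertex v => F.vert v
  | .edge e => F.edge e
  | .ghost e => F.ghost e

variable (K : Type w) [Field K] [Algebra K R]

/-- The homomorphism given by a family satisfying the Leavitt relations. -/
noncomputable def LeavittFamily.lift (F : LeavittFamily E R) :
    E.UnitalLeavittAlgebra K →ₐ[K] R :=
  RingQuot.liftAlgHom K ⟨FreeAlgebra.lift K F.gen, by
    intro x y h
    cases h with
    | vertex_mul_self v =>
      simpa [freeVertex, LeavittFamily.gen] using F.vert_mul_self v
    | vertex_mul_of_ne v v' h =>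
      simpa [freeVertex, LeavittFamily.gen] using F.vert_mul_of_ne v v' h
    | source_mul_edge e =>
      simpa [freeVertex, freeEdge, LeavittFamily.gen] using F.source_mul_edge e
    | edge_mul_range e =>
      simpa [freeVertex, freeEdge, LeavittFamily.gen] using F.edge_mul_range e
    | range_mul_ghost e =>
      simpa [freeVertex, freeGhost, LeavittFamily.gen] using F.range_mul_ghost e
    | ghost_mul_source e =>
      simpa [freeVertex, freeGhost, LeavittFamily.gen] using F.ghost_mul_source e
    | ghost_mul_self e =>
      simpa [freeVertex, freeEdge, freeGhost, LeavittFamily.gen] using F.ghost_mul_self e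
    | ghost_mul_of_ne e f h =>
      simpa [freeEdge, freeGhost, LeavittFamily.gen] using F.ghost_mul_of_ne e f h
    | vertex_eq_sum v h =>
      simpa [freeVertex, freeEdge, freeGhost, LeavittFamily.gen, map_sum] using
        F.vert_eq_sum v h⟩

@[simp] theorem LeavittFamily.lift_generator (F : LeavittFamily E R) (g : E.Generator) :
    F.lift K (E.unitalGenerator K g) = F.gen g := by
  simp [LeavittFamily.lift, unitalGenerator]

variable (E)

/-- The universal family, consisting of the generators of the Leavitt path algebra. -/
noncomputable def universalFamily : LeavittFamily E (E.UnitalLeavittAlgebra K) where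
  vert v := E.unitalGenerator K (.vertex v)
  edge e := E.unitalGenerator K (.edge e)
  ghost e := E.unitalGenerator K (.ghost e)
  vert_mul_self v := by
    have := RingQuot.mkAlgHom_rel K (LeavittRel.vertex_mul_self (K := K) (E := E) v)
    simpa [unitalGenerator, freeVertex] using this
  vert_mul_of_ne v v' h := by
    have := RingQuot.mkAlgHom_rel K (LeavittRel.vertex_mul_of_ne (K := K) (E := E) v v' h)
    simpa [unitalGenerator, freeVertex] using this
  source_mul_edge e := by
    have := RingQuot.mkAlgHom_rel K (LeavittRel.source_mul_edge (K := K) (E := E) e)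
    simpa [unitalGenerator, freeVertex, freeEdge] using this
  edge_mul_range e := by
    have := RingQuot.mkAlgHom_rel K (LeavittRel.edge_mul_range (K := K) (E := E) e)
    simpa [unitalGenerator, freeVertex, freeEdge] using this
  range_mul_ghost e := by
    have := RingQuot.mkAlgHom_rel K (LeavittRel.range_mul_ghost (K := K) (E := E) e)
    simpa [unitalGenerator, freeVertex, freeGhost] using this
  ghost_mul_source e := by
    have := RingQuot.mkAlgHom_rel K (LeavittRel.ghost_mul_source (K := K) (E := E) e)
    simpa [unitalGenerator, freeVertex, freeGhost] using this
  ghost_mul_self e := by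
    have := RingQuot.mkAlgHom_rel K (LeavittRel.ghost_mul_self (K := K) (E := E) e)
    simpa [unitalGenerator, freeVertex, freeEdge, freeGhost] using this
  ghost_mul_of_ne e f h := by
    have := RingQuot.mkAlgHom_rel K (LeavittRel.ghost_mul_of_ne (K := K) (E := E) e f h)
    simpa [unitalGenerator, freeEdge, freeGhost] using this
  vert_eq_sum v h := by
    have := RingQuot.mkAlgHom_rel K (LeavittRel.vertex_eq_sum (K := K) (E := E) v h)
    simpa [unitalGenerator, freeVertex, freeEdge, freeGhost] using this

theorem universalFamily_gen (g : E.Generator) :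
    (E.universalFamily K).gen g = E.unitalGenerator K g := by
  cases g <;> rfl

end Families

/-! ### Matrix families -/

section MatrixFamilies

/-- The matrix unit `r E_{xy}` as an operator on `V → R`. -/
noncomputable def matUnit (K : Type*) [Field K] {V R : Type*} [Ring R] [Algebra K R]
    (x y : V) (r : R) : Module.End K (V → R) := by
  classical
  exact (LinearMap.single K (fun _ : V => R) x) ∘ₗ (LinearMap.mulLeft K r) ∘ₗ (LinearMap.proj y)

variable {K : Type*} [Field K] {V R : Type*} [Ring R] [Algebra K R]

theorem matUnit_apply_self (x y : V) (r : R) (f : V → R) : matUnit K x y r f x = r * f y := by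
  simp [matUnit]

theorem matUnit_apply_of_ne {x z : V} (h : z ≠ x) (y : V) (r : R) (f : V → R) :
    matUnit K x y r f z = 0 := by
  simp [matUnit, h]

theorem matUnit_mul (x y z : V) (r s : R) :
    matUnit K x y r * matUnit K y z s = matUnit K x z (r * s) := by
  ext1 f
  funext a
  rw [Module.End.mul_apply]
  by_cases h : a = x
  · subst h
    rw [matUnit_apply_self, matUnit_apply_self, matUnit_apply_self, mul_assoc]
  · rw [matUnit_apply_of_ne h, matUnit_apply_of_ne h]

theorem matUnit_mul_of_ne {y y' : V} (h : y ≠ y') (x z : V) (r s : R) :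
    matUnit K x y r * matUnit K y' z s = 0 := by
  ext1 f
  funext a
  rw [Module.End.mul_apply]
  by_cases ha : a = x
  · subst ha
    rw [matUnit_apply_self, matUnit_apply_of_ne h, mul_zero]; rfl
  · rw [matUnit_apply_of_ne ha]; rfl

theorem matUnit_zero (x y : V) : matUnit K x y (0 : R) = 0 := by
  ext1 f
  funext a
  by_cases ha : a = x
  · subst ha
    rw [matUnit_apply_self, zero_mul]; rfl
  · rw [matUnit_apply_of_ne ha]; rfl

theorem matUnit_sum {ι : Type*} (s : Finset ι) (x y : V) (r : ι → R) :
    matUnit K x y (∑ i ∈ s, r i) = ∑ i ∈ s, matUnit K x y (r i) := by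
  ext1 f
  funext a
  rw [LinearMap.sum_apply, Finset.sum_apply]
  by_cases ha : a = x
  · subst ha
    simp only [matUnit_apply_self, Finset.sum_mul]
  · simp only [matUnit_apply_of_ne ha, Finset.sum_const_zero]

/-- Data for a representation of the Leavitt path algebra by matrices over `R` indexed by the
vertices, where `v` acts as `p v E_{vv}`, `e` as `c e E_{s(e)r(e)}` and `e*` as
`d e E_{r(e)s(e)}`. -/
structure MatrixFamily (E : DirectedGraph.{u}) (R : Type*) [Ring R] where
  p : E.Vertex → R
  c : E.Edge → R
  d : E.Edge → R
  p_mul_self : ∀ v, p v * p v = p v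
  p_mul_c : ∀ e, p (E.source e) * c e = c e
  c_mul_p : ∀ e, c e * p (E.range e) = c e
  p_mul_d : ∀ e, p (E.range e) * d e = d e
  d_mul_p : ∀ e, d e * p (E.source e) = d e
  d_mul_c : ∀ e, d e * c e = p (E.range e)
  d_mul_c_of_ne : ∀ e f, e ≠ f → E.source e = E.source f → d e * c f = 0
  p_eq_sum : ∀ v (h : E.IsRegular v), p v = ∑ e ∈ h.2.toFinset, c e * d e

variable (K) in
/-- The Leavitt family of operators given by a matrix family. -/
noncomputable def MatrixFamily.toLeavittFamily {E : DirectedGraph.{u}} (F : MatrixFamily E R) :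
    LeavittFamily E (Module.End K (E.Vertex → R)) where
  vert v := matUnit K v v (F.p v)
  edge e := matUnit K (E.source e) (E.range e) (F.c e)
  ghost e := matUnit K (E.range e) (E.source e) (F.d e)
  vert_mul_self v := by rw [matUnit_mul, F.p_mul_self]
  vert_mul_of_ne v v' h := matUnit_mul_of_ne h _ _ _ _
  source_mul_edge e := by rw [matUnit_mul, F.p_mul_c]
  edge_mul_range e := by rw [matUnit_mul, F.c_mul_p]
  range_mul_ghost e := by rw [matUnit_mul, F.p_mul_d]
  ghost_mul_source e := by rw [matUnit_mul, F.d_mul_p]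
  ghost_mul_self e := by rw [matUnit_mul, F.d_mul_c]
  ghost_mul_of_ne e f h := by
    by_cases hs : E.source e = E.source f
    · rw [hs, matUnit_mul, F.d_mul_c_of_ne e f h hs, matUnit_zero]
    · exact matUnit_mul_of_ne hs _ _ _ _
  vert_eq_sum v h := by
    conv_lhs => rw [F.p_eq_sum v h, matUnit_sum]
    refine Finset.sum_congr rfl fun e he => ?_
    have : E.source e = v := by simpa [emitted] using he
    rw [matUnit_mul, this]

end MatrixFamilies

/-! ### Local units and nontriviality -/

section LocalUnits

variable (E : DirectedGraph.{u}) (K : Type w) [Field K]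

/-- The set `ℕ ⊕ E.Edge` is infinite and at least as large as every `s⁻¹(v)`, so it absorbs a
nonempty `s⁻¹(v)` as a factor. The summand `ℕ` guarantees infinity when `E` has few edges. -/
theorem exists_emitted_prod_equiv (v : E.Vertex) (h : (E.emitted v).Nonempty) :
    Nonempty (E.emitted v × (ℕ ⊕ E.Edge) ≃ (ℕ ⊕ E.Edge)) := by
  have hX : Cardinal.aleph0 ≤ Cardinal.mk (ℕ ⊕ E.Edge) := Cardinal.infinite_iff.1 inferInstance
  have hle : Cardinal.mk (E.emitted v) ≤ Cardinal.mk (ℕ ⊕ E.Edge) :=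
    ⟨⟨fun e => Sum.inr e, fun a b hab => Subtype.ext (Sum.inr_injective hab)⟩⟩
  have hne : Cardinal.mk (E.emitted v) ≠ 0 := by
    rw [Cardinal.mk_ne_zero_iff]; exact h.to_subtype
  refine Cardinal.eq.1 ?_
  rw [Cardinal.mk_prod]
  simpa using Cardinal.mul_eq_right hX hle hne

/-- A branching system on the single set `X = ℕ ⊕ E.Edge`: at each vertex that is not a sink, `X` is
partitioned into copies `θ e X` of itself, one for each emitted edge. Here `a` names the block of a
point and `b` its coordinate in that block. -/
theorem exists_branching : ∃ (θ : E.Edge → (ℕ ⊕ E.Edge) → (ℕ ⊕ E.Edge))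
    (a : E.Vertex → (ℕ ⊕ E.Edge) → Option E.Edge)
    (b : E.Vertex → (ℕ ⊕ E.Edge) → (ℕ ⊕ E.Edge)),
    (∀ e x, a (E.source e) (θ e x) = some e ∧ b (E.source e) (θ e x) = x) ∧
    ∀ v, (E.emitted v).Nonempty →
      ∀ y, ∃ e ∈ E.emitted v, a v y = some e ∧ θ e (b v y) = y := by
  have H : ∀ v : E.Vertex, ∃ (θ : E.emitted v → (ℕ ⊕ E.Edge) → (ℕ ⊕ E.Edge))
      (a : (ℕ ⊕ E.Edge) → Option E.Edge) (b : (ℕ ⊕ E.Edge) → (ℕ ⊕ E.Edge)),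
      (∀ e x, a (θ e x) = some e.1 ∧ b (θ e x) = x) ∧
      ((E.emitted v).Nonempty → ∀ y, ∃ e, a y = some e.1 ∧ θ e (b y) = y) := by
    intro v
    by_cases h : (E.emitted v).Nonempty
    · obtain ⟨ε⟩ := E.exists_emitted_prod_equiv v h
      refine ⟨fun e x => ε (e, x), fun y => some (ε.symm y).1, fun y => (ε.symm y).2,
        fun e x => by simp, fun _ y => ⟨(ε.symm y).1, rfl, by simp⟩⟩
    · exact ⟨fun _ x => x, fun _ => none, fun x => x, fun e => absurd ⟨e.1, e.2⟩ h,
        fun h' => absurd h' h⟩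
  choose θ a b h1 h2 using H
  refine ⟨fun e => θ (E.source e) ⟨e, rfl⟩, a, b, fun e x => h1 _ ⟨e, rfl⟩ x, fun v hv y => ?_⟩
  obtain ⟨⟨e, rfl⟩, he⟩ := h2 v hv y
  exact ⟨e, rfl, he⟩

-- On functions on the branching set, `e*` acts by restriction along `θ e` and `e` by extension by
-- zero from the block `θ e X`. The blocks at one vertex are disjoint and cover `X`, which gives the
-- two Cuntz-Krieger relations with every vertex coefficient equal to `1`.
open Classical in
theorem exists_matrixFamily_one :
    ∃ F : MatrixFamily E (Module.End K ((ℕ ⊕ E.Edge) → K)), ∀ v, F.p v = 1 := by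
  obtain ⟨θ, a, b, h1, h2⟩ := E.exists_branching
  let c : E.Edge → Module.End K ((ℕ ⊕ E.Edge) → K) := fun e =>
    { toFun := fun f y => if a (E.source e) y = some e then f (b (E.source e) y) else 0
      map_add' := fun f g => by
        funext y; by_cases h : a (E.source e) y = some e <;> simp [h]
      map_smul' := fun k f => by
        funext y; by_cases h : a (E.source e) y = some e <;> simp [h] }
  let d : E.Edge → Module.End K ((ℕ ⊕ E.Edge) → K) := fun e => LinearMap.funLeft K K (θ e)
  have hc : ∀ e f y, c e f y = if a (E.source e) y = some e then f (b (E.source e) y) else 0 :=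
    fun e f y => rfl
  have hd : ∀ e f x, d e f x = f (θ e x) := fun e f x => rfl
  refine ⟨⟨fun _ => 1, c, d, fun v => one_mul _, fun e => one_mul _, fun e => mul_one _,
    fun e => one_mul _, fun e => mul_one _, ?_, ?_, ?_⟩, fun v => rfl⟩
  · intro e
    refine LinearMap.ext fun f => funext fun x => ?_
    rw [Module.End.mul_apply, hd, hc, if_pos (h1 e x).1, (h1 e x).2]; rfl
  · intro e e' hne hs
    refine LinearMap.ext fun f => funext fun x => ?_
    rw [Module.End.mul_apply, hd, hc, ← hs, if_neg]
    · rfl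
    · rw [(h1 e x).1]
      exact fun h => hne (Option.some_injective _ h)
  · intro v hv
    refine LinearMap.ext fun f => funext fun y => ?_
    obtain ⟨e, he, hay, hby⟩ := h2 v hv.1 y
    have hsum : (∑ e' ∈ hv.2.toFinset, c e' * d e') f y =
        ∑ e' ∈ hv.2.toFinset, if e' = e then f y else 0 := by
      rw [LinearMap.sum_apply, Finset.sum_apply]
      refine Finset.sum_congr rfl fun e' he' => ?_
      have hs : E.source e' = v := by simpa [emitted] using he'
      rw [Module.End.mul_apply, hc, hs, hay, hd]
      by_cases h : e' = e
      · subst h; rw [if_pos rfl, if_pos rfl, hby]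
      · rw [if_neg h, if_neg]
        exact fun h' => h (Option.some_injective _ h').symm
    rw [hsum, Finset.sum_ite_eq' , if_pos (hv.2.mem_toFinset.2 he)]; rfl

theorem unitalGenerator_vertex_ne_zero (v : E.Vertex) :
    E.unitalGenerator K (.vertex v) ≠ 0 := by
  intro h
  obtain ⟨F, hF⟩ := E.exists_matrixFamily_one K
  have h1 := (F.toLeavittFamily K).lift_generator K (.vertex v)
  rw [h, map_zero] at h1
  have h2 : matUnit K v v (F.p v) = 0 := h1.symm
  have h3 := congrArg (fun T => T (fun _ => 1) v (fun _ => 1) (Sum.inl 0)) h2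
  simp only [matUnit_apply_self, hF] at h3
  exact one_ne_zero h3

/-- The sum of the vertices in a finite set, as an element of the unital algebra. -/
noncomputable def unitalVertexSum (A : Finset E.Vertex) : E.UnitalLeavittAlgebra K :=
  ∑ v ∈ A, (E.universalFamily K).vert v

variable {E K}

theorem LeavittFamily.vert_mul_vert {R : Type*} [Ring R] [DecidableEq E.Vertex]
    (F : LeavittFamily E R) (v w : E.Vertex) :
    F.vert v * F.vert w = if v = w then F.vert v else 0 := by
  split_ifs with h
  · rw [← h, F.vert_mul_self]
  · exact F.vert_mul_of_ne v w h

theorem LeavittFamily.sum_vert_mul {R : Type*} [Ring R]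
    (F : LeavittFamily E R) {A : Finset E.Vertex} {v : E.Vertex} (hv : v ∈ A) {x : R}
    (hx : F.vert v * x = x) : (∑ w ∈ A, F.vert w) * x = x := by
  classical
  rw [← hx, ← mul_assoc, Finset.sum_mul]
  simp [F.vert_mul_vert, hv]

theorem LeavittFamily.mul_sum_vert {R : Type*} [Ring R]
    (F : LeavittFamily E R) {A : Finset E.Vertex} {v : E.Vertex} (hv : v ∈ A) {x : R}
    (hx : x * F.vert v = x) : x * (∑ w ∈ A, F.vert w) = x := by
  classical
  rw [← hx, mul_assoc, Finset.mul_sum]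
  simp [F.vert_mul_vert, hv]

/-- The Leavitt path algebra inside the unital algebra. -/
abbrev unitalSubalgebra (E : DirectedGraph.{u}) (K : Type w) [Field K] :
    NonUnitalSubalgebra K (E.UnitalLeavittAlgebra K) :=
  NonUnitalAlgebra.adjoin K (Set.range (E.unitalGenerator K))

/-- Requiring the unit property for all `B ⊇ A` is what lets the finite sets of two elements be
merged in the induction. -/
theorem exists_unitalVertexSum_mul {x : E.UnitalLeavittAlgebra K}
    (hx : x ∈ unitalSubalgebra E K) : ∃ A : Finset E.Vertex, ∀ B, A ⊆ B →
      E.unitalVertexSum K B * x = x ∧ x * E.unitalVertexSum K B = x := by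
  classical
  let F := E.universalFamily K
  induction hx using NonUnitalAlgebra.adjoin_induction with
  | mem x hx =>
    obtain ⟨g, rfl⟩ := hx
    rw [← universalFamily_gen]
    cases g with
    | vertex v =>
      refine ⟨{v}, fun B hB => ?_⟩
      have hv : v ∈ B := hB (by simp)
      exact ⟨F.sum_vert_mul hv (F.vert_mul_self v), F.mul_sum_vert hv (F.vert_mul_self v)⟩
    | edge e =>
      refine ⟨{E.source e, E.range e}, fun B hB => ?_⟩
      exact ⟨F.sum_vert_mul (hB (by simp)) (F.source_mul_edge e),
        F.mul_sum_vert (hB (by simp)) (F.edge_mul_range e)⟩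
    | ghost e =>
      refine ⟨{E.source e, E.range e}, fun B hB => ?_⟩
      exact ⟨F.sum_vert_mul (hB (by simp)) (F.range_mul_ghost e),
        F.mul_sum_vert (hB (by simp)) (F.ghost_mul_source e)⟩
  | add x y _ _ hx hy =>
    obtain ⟨A, hA⟩ := hx
    obtain ⟨A', hA'⟩ := hy
    refine ⟨A ∪ A', fun B hB => ?_⟩
    have h1 := hA B (Finset.union_subset_left hB)
    have h2 := hA' B (Finset.union_subset_right hB)
    rw [mul_add, add_mul, h1.1, h1.2, h2.1, h2.2]
    exact ⟨rfl, rfl⟩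
  | zero => exact ⟨∅, fun B _ => ⟨mul_zero _, zero_mul _⟩⟩
  | mul x y _ _ hx hy =>
    obtain ⟨A, hA⟩ := hx
    obtain ⟨A', hA'⟩ := hy
    refine ⟨A ∪ A', fun B hB => ?_⟩
    have h1 := hA B (Finset.union_subset_left hB)
    have h2 := hA' B (Finset.union_subset_right hB)
    rw [← mul_assoc, h1.1, mul_assoc, h2.2]
    exact ⟨rfl, rfl⟩
  | smul k x _ hx =>
    obtain ⟨A, hA⟩ := hx
    refine ⟨A, fun B hB => ?_⟩
    rw [mul_smul_comm, smul_mul_assoc, (hA B hB).1, (hA B hB).2]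
    exact ⟨rfl, rfl⟩

theorem unitalVertexSum_mul_self (A : Finset E.Vertex) :
    E.unitalVertexSum K A * E.unitalVertexSum K A = E.unitalVertexSum K A := by
  conv_lhs => rw [unitalVertexSum, Finset.mul_sum]
  exact Finset.sum_congr rfl fun v hv =>
    (E.universalFamily K).sum_vert_mul hv ((E.universalFamily K).vert_mul_self v)

@[simp] theorem coe_vertexSum (A : Finset E.Vertex) :
    (E.vertexSum K A : E.UnitalLeavittAlgebra K) = E.unitalVertexSum K A := by
  rw [vertexSum, unitalVertexSum]
  exact map_sum (NonUnitalSubalgebraClass.subtype (unitalSubalgebra E K)) _ _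

theorem exists_vertexSum_mul (s : Finset (E.LeavittPathAlgebra K)) :
    ∃ A : Finset E.Vertex, ∀ x ∈ s, E.vertexSum K A * x = x ∧ x * E.vertexSum K A = x := by
  classical
  choose A hA using fun x : E.LeavittPathAlgebra K => exists_unitalVertexSum_mul x.2
  refine ⟨s.biUnion A, fun x hx => ?_⟩
  have h := hA x (s.biUnion A) (Finset.subset_biUnion_of_mem A hx)
  exact ⟨Subtype.ext (by simpa using h.1), Subtype.ext (by simpa using h.2)⟩

theorem hasLocalUnits_leavittPathAlgebra (E : DirectedGraph.{u}) (K : Type w) [Field K] :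
    HasLocalUnits (E.LeavittPathAlgebra K) := fun s => by
  obtain ⟨A, hA⟩ := exists_vertexSum_mul s
  exact ⟨E.vertexSum K A, hA⟩

end LocalUnits

/-! ### The graph with tails -/

section TailGraph

variable {E : DirectedGraph.{u}} (L : E.EdgeListing)

/-- The vertex `vₙ` on the tail at `v`, as a vertex of the graph with tails. -/
def tailV (v : {v : E.Vertex // E.IsSingular v}) (n : ℕ) : (E.addTails L).Vertex :=
  E.tailVertex v n

/-- The edge of the graph with tails that corresponds to an edge of `E`. -/
def oldEdge (e : E.Edge) : (E.addTails L).Edge := Sum.inl e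

/-- The edge `vₙ → vₙ₊₁` of the tail at `v`. -/
def tailEdge (v : {v : E.Vertex // E.IsSingular v}) (n : ℕ) : (E.addTails L).Edge := Sum.inr (v, n)

theorem addTailsVertex_injective : Function.Injective (addTailsVertex L) := Sum.inl_injective

theorem oldEdge_injective : Function.Injective (oldEdge L) := Sum.inl_injective

theorem oldEdge_ne_tailEdge (e : E.Edge) (v n) : oldEdge L e ≠ tailEdge L v n := nofun

theorem tailV_zero (v : {v : E.Vertex // E.IsSingular v}) :
    tailV L v 0 = addTailsVertex L v := rfl

variable {L} in
theorem tailV_injective {v v' : {v : E.Vertex // E.IsSingular v}} {n n' : ℕ}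
    (h : tailV L v n = tailV L v' n') : v = v' ∧ n = n' := by
  have h' : E.tailVertex v n = E.tailVertex v' n' := h
  cases n <;> cases n' <;> simp_all [tailVertex, Subtype.ext_iff]

theorem tailV_ne_of_isRegular {v : {v : E.Vertex // E.IsSingular v}} {n : ℕ}
    {u : E.Vertex} (hu : E.IsRegular u) : tailV L v n ≠ addTailsVertex L u := by
  cases n with
  | zero => intro h; exact v.2 (addTailsVertex_injective L h ▸ hu)
  | succ n => exact nofun

@[simp] theorem source_tailEdge (v : {v : E.Vertex // E.IsSingular v}) (n : ℕ) :
    (E.addTails L).source (tailEdge L v n) = tailV L v n := rfl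

@[simp] theorem range_tailEdge (v : {v : E.Vertex // E.IsSingular v}) (n : ℕ) :
    (E.addTails L).range (tailEdge L v n) = tailV L v (n + 1) := rfl

@[simp] theorem range_oldEdge (e : E.Edge) :
    (E.addTails L).range (oldEdge L e) = addTailsVertex L (E.range e) := rfl

theorem source_oldEdge_of_isRegular {e : E.Edge} (h : E.IsRegular (E.source e)) :
    (E.addTails L).source (oldEdge L e) = addTailsVertex L (E.source e) :=
  dif_neg fun h' => h' h.2

theorem source_listing (v : E.Vertex) (h : E.IsInfiniteEmitter v) (n : ℕ) :
    E.source (L v h n) = v := (L v h n).2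

theorem source_oldEdge_listing (v : E.Vertex) (h : E.IsInfiniteEmitter v) (n : ℕ) :
    (E.addTails L).source (oldEdge L (L v h n)) = tailV L ⟨v, h.isSingular⟩ n := by
  have key : ∀ (e : E.Edge) (he : E.source e = v), (⟨e, he⟩ : E.emitted v) = L v h n →
      (E.addTails L).source (oldEdge L e) = tailV L ⟨v, h.isSingular⟩ n := by
    rintro e rfl heq
    refine (dif_pos h).trans ?_
    rw [heq, Equiv.symm_apply_apply]; rfl
  exact key _ (source_listing L v h n) rfl

/-- An edge of `E` starts at a regular vertex, or it occurs in the listing of the edges of an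
infinite emitter. -/
theorem isRegular_source_or_exists_listing (e : E.Edge) :
    E.IsRegular (E.source e) ∨ ∃ v h n, e = L v h n := by
  by_cases h : E.IsInfiniteEmitter (E.source e)
  · exact Or.inr ⟨E.source e, h, (L _ h).symm ⟨e, rfl⟩, by rw [Equiv.apply_symm_apply]⟩
  · exact Or.inl ⟨⟨e, rfl⟩, Set.not_infinite.1 h⟩

/-- A vertex of the graph with tails is a regular vertex of `E` or lies on a tail. -/
theorem addTails_vertex_cases (x : (E.addTails L).Vertex) :
    (∃ v, E.IsRegular v ∧ x = addTailsVertex L v) ∨ ∃ v n, x = tailV L v n := by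
  rcases x with v | ⟨v, n⟩
  · by_cases h : E.IsRegular v
    · exact Or.inl ⟨v, h, rfl⟩
    · exact Or.inr ⟨⟨v, h⟩, 0, rfl⟩
  · exact Or.inr ⟨v, n + 1, rfl⟩

theorem addTails_edge_cases (e : (E.addTails L).Edge) :
    (∃ f, e = oldEdge L f) ∨ ∃ v n, e = tailEdge L v n := by
  rcases e with f | ⟨v, n⟩
  · exact Or.inl ⟨f, rfl⟩
  · exact Or.inr ⟨v, n, rfl⟩

theorem addTails_vertex_induction {p : (E.addTails L).Vertex → Prop}
    (h0 : ∀ v, p (addTailsVertex L v))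
    (h1 : ∀ v n, p (tailV L v n) → p (tailV L v (n + 1))) (x : (E.addTails L).Vertex) :
    p x := by
  have key : ∀ v n, p (tailV L v n) := fun v n => by
    induction n with
    | zero => exact h0 _
    | succ n ih => exact h1 v n ih
  rcases x with v | ⟨v, n⟩
  · exact h0 v
  · exact key v (n + 1)

/-- Recursion along the tails. -/
def tailRec {α : Type*} (f : E.Vertex → α) (g : {v : E.Vertex // E.IsSingular v} → ℕ → α → α) :
    (E.addTails L).Vertex → α
  | .inl v => f v
  | .inr (v, n) => Nat.rec (g v 0 (f v)) (fun n x => g v (n + 1) x) n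

theorem tailRec_succ {α : Type*} (f : E.Vertex → α)
    (g : {v : E.Vertex // E.IsSingular v} → ℕ → α → α) (v) (n : ℕ) :
    tailRec L f g (tailV L v (n + 1)) = g v n (tailRec L f g (tailV L v n)) := by
  cases n <;> rfl

theorem addTails_emitted_addTailsVertex {v : E.Vertex} (hv : E.IsRegular v) :
    (E.addTails L).emitted (addTailsVertex L v) = oldEdge L '' E.emitted v := by
  ext e
  constructor
  · intro he
    rcases addTails_edge_cases L e with ⟨e, rfl⟩ | ⟨w, n, rfl⟩
    · refine ⟨e, ?_, rfl⟩
      rcases isRegular_source_or_exists_listing L e with h | ⟨w, h, n, rfl⟩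
      · exact addTailsVertex_injective L ((source_oldEdge_of_isRegular L h).symm.trans he)
      · exact absurd ((source_oldEdge_listing L w h n).symm.trans he)
          (tailV_ne_of_isRegular L hv)
    · exact absurd he (tailV_ne_of_isRegular L hv)
  · rintro ⟨e, he, rfl⟩
    have hs : E.source e = v := he
    exact (source_oldEdge_of_isRegular L (hs ▸ hv)).trans (congrArg _ hs)

theorem addTails_mem_emitted_tailV {v : {v : E.Vertex // E.IsSingular v}} {n : ℕ}
    {e : (E.addTails L).Edge} : e ∈ (E.addTails L).emitted (tailV L v n) ↔
      e = tailEdge L v n ∨ ∃ h : E.IsInfiniteEmitter v, e = oldEdge L (L v h n) := by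
  constructor
  · intro he
    rcases addTails_edge_cases L e with ⟨e, rfl⟩ | ⟨w, m, rfl⟩
    · rcases isRegular_source_or_exists_listing L e with h | ⟨w, h, m, rfl⟩
      · exact absurd (he.symm.trans (source_oldEdge_of_isRegular L h))
          (tailV_ne_of_isRegular L h)
      · obtain ⟨rfl, rfl⟩ := tailV_injective ((source_oldEdge_listing L w h m).symm.trans he)
        exact Or.inr ⟨h, rfl⟩
    · obtain ⟨rfl, rfl⟩ := tailV_injective (L := L) he
      exact Or.inl rfl
  · rintro (rfl | ⟨h, rfl⟩)
    · rfl
    · exact source_oldEdge_listing L v h n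

theorem addTails_emitted_of_isInfiniteEmitter {v : {v : E.Vertex // E.IsSingular v}} (n : ℕ)
    (h : E.IsInfiniteEmitter v) :
    (E.addTails L).emitted (tailV L v n) = {tailEdge L v n, oldEdge L (L v h n)} := by
  ext e
  rw [addTails_mem_emitted_tailV]
  exact or_congr Iff.rfl ⟨fun ⟨_, he⟩ => he, fun he => ⟨h, he⟩⟩

theorem addTails_emitted_of_not_isInfiniteEmitter {v : {v : E.Vertex // E.IsSingular v}} (n : ℕ)
    (h : ¬ E.IsInfiniteEmitter v) :
    (E.addTails L).emitted (tailV L v n) = {tailEdge L v n} := by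
  ext e
  rw [addTails_mem_emitted_tailV]
  exact ⟨fun he => he.elim id fun ⟨h', _⟩ => absurd h' h, Or.inl⟩

/-- Every vertex of a tail emits its tail edge and at most one further edge; this is why one vertex
is provided for each entry of a listing. -/
theorem addTails_isRegular (x : (E.addTails L).Vertex) : (E.addTails L).IsRegular x := by
  rcases addTails_vertex_cases L x with ⟨v, hv, rfl⟩ | ⟨v, n, rfl⟩
  · have := addTails_emitted_addTailsVertex L hv
    exact ⟨this ▸ hv.1.image _, this ▸ hv.2.image _⟩
  · by_cases h : E.IsInfiniteEmitter v
    · have := addTails_emitted_of_isInfiniteEmitter L n h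
      exact ⟨this ▸ ⟨_, Or.inl rfl⟩, this ▸ Set.toFinite _⟩
    · have := addTails_emitted_of_not_isInfiniteEmitter L n h
      exact ⟨this ▸ ⟨_, rfl⟩, this ▸ Set.toFinite _⟩

variable {L}

theorem addTails_sum_addTailsVertex {M : Type*} [AddCommMonoid M] {v : E.Vertex}
    (hv : E.IsRegular v) (h : (E.addTails L).IsRegular (addTailsVertex L v))
    (f : (E.addTails L).Edge → M) :
    ∑ e ∈ Set.Finite.toFinset h.2, f e = ∑ e ∈ Set.Finite.toFinset hv.2, f (oldEdge L e) := by
  classical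
  have : Set.Finite.toFinset h.2 =
      (Set.Finite.toFinset hv.2).map ⟨oldEdge L, oldEdge_injective L⟩ := by
    apply Finset.coe_injective
    rw [Set.Finite.coe_toFinset, Finset.coe_map, Set.Finite.coe_toFinset]
    exact addTails_emitted_addTailsVertex L hv
  rw [this, Finset.sum_map]; rfl

open Classical in
theorem addTails_sum_tailV {M : Type*} [AddCommMonoid M]
    {v : {v : E.Vertex // E.IsSingular v}} {n : ℕ}
    (hr : (E.addTails L).IsRegular (tailV L v n)) (f : (E.addTails L).Edge → M) :
    ∑ e ∈ Set.Finite.toFinset hr.2, f e =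
      f (tailEdge L v n) + if h : E.IsInfiniteEmitter v then f (oldEdge L (L v h n)) else 0 := by
  by_cases h : E.IsInfiniteEmitter v
  · have : Set.Finite.toFinset hr.2 = {tailEdge L v n, oldEdge L (L v h n)} := by
      apply Finset.coe_injective
      rw [Set.Finite.coe_toFinset, addTails_emitted_of_isInfiniteEmitter L n h]
      simp
    rw [dif_pos h, this, Finset.sum_pair (oldEdge_ne_tailEdge L _ _ _).symm]
  · have : Set.Finite.toFinset hr.2 = {tailEdge L v n} := by
      apply Finset.coe_injective
      rw [Set.Finite.coe_toFinset, addTails_emitted_of_not_isInfiniteEmitter L n h]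
      simp
    rw [dif_neg h, this, Finset.sum_singleton, add_zero]

variable (L) in
/-- The vertex of `E` to which the tail of a vertex is attached. -/
def tailBase : (E.addTails L).Vertex → E.Vertex := tailRec L id fun _ _ x => x

@[simp] theorem tailBase_addTailsVertex (v : E.Vertex) :
    tailBase L (addTailsVertex L v) = v := rfl

@[simp] theorem tailBase_tailV (v : {v : E.Vertex // E.IsSingular v}) (n : ℕ) :
    tailBase L (tailV L v n) = v := by
  induction n with
  | zero => rfl
  | succ n ih => rw [tailBase, tailRec_succ]; exact ih

theorem tailBase_source_oldEdge (e : E.Edge) :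
    tailBase L ((E.addTails L).source (oldEdge L e)) = E.source e := by
  rcases isRegular_source_or_exists_listing L e with h | ⟨v, h, n, rfl⟩
  · rw [source_oldEdge_of_isRegular L h]; rfl
  · rw [source_oldEdge_listing, tailBase_tailV, source_listing]

end TailGraph

/-! ### The homomorphism `L(E) → L(F)` -/

section TailPaths

variable {E : DirectedGraph.{u}} {L : E.EdgeListing} {R : Type*} [Ring R]
  (G : LeavittFamily (E.addTails L) R)

/-- The product of the edges of the tail from the base to the given vertex. -/
def tailPath : (E.addTails L).Vertex → R :=
  tailRec L (fun v => G.vert (addTailsVertex L v)) fun v n x => x * G.edge (tailEdge L v n)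

/-- The product of the ghost edges of the tail from the given vertex to the base. -/
def tailGhost : (E.addTails L).Vertex → R :=
  tailRec L (fun v => G.vert (addTailsVertex L v)) fun v n x => G.ghost (tailEdge L v n) * x

theorem tailPath_addTailsVertex (v : E.Vertex) :
    tailPath G (addTailsVertex L v) = G.vert (addTailsVertex L v) := rfl

theorem tailGhost_addTailsVertex (v : E.Vertex) :
    tailGhost G (addTailsVertex L v) = G.vert (addTailsVertex L v) := rfl

theorem tailPath_succ (v : {v : E.Vertex // E.IsSingular v}) (n : ℕ) :
    tailPath G (tailV L v (n + 1)) = tailPath G (tailV L v n) * G.edge (tailEdge L v n) :=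
  tailRec_succ L _ _ v n

theorem tailGhost_succ (v : {v : E.Vertex // E.IsSingular v}) (n : ℕ) :
    tailGhost G (tailV L v (n + 1)) = G.ghost (tailEdge L v n) * tailGhost G (tailV L v n) :=
  tailRec_succ L _ _ v n

theorem tailBase_mul_tailPath (x : (E.addTails L).Vertex) :
    G.vert (addTailsVertex L (tailBase L x)) * tailPath G x = tailPath G x := by
  induction x using addTails_vertex_induction with
  | h0 v => exact G.vert_mul_self _
  | h1 v n ih =>
    rw [tailBase_tailV] at ih ⊢
    rw [tailPath_succ, ← mul_assoc, ih]

theorem tailGhost_mul_tailBase (x : (E.addTails L).Vertex) :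
    tailGhost G x * G.vert (addTailsVertex L (tailBase L x)) = tailGhost G x := by
  induction x using addTails_vertex_induction with
  | h0 v => exact G.vert_mul_self _
  | h1 v n ih =>
    rw [tailBase_tailV] at ih ⊢
    rw [tailGhost_succ, mul_assoc, ih]

theorem tailPath_mul_vert (x : (E.addTails L).Vertex) :
    tailPath G x * G.vert x = tailPath G x := by
  induction x using addTails_vertex_induction with
  | h0 v => exact G.vert_mul_self _
  | h1 v n _ =>
    rw [tailPath_succ, mul_assoc]
    exact congrArg _ (G.edge_mul_range (tailEdge L v n))

theorem vert_mul_tailGhost (x : (E.addTails L).Vertex) :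
    G.vert x * tailGhost G x = tailGhost G x := by
  induction x using addTails_vertex_induction with
  | h0 v => exact G.vert_mul_self _
  | h1 v n _ =>
    rw [tailGhost_succ, ← mul_assoc]
    exact congrArg (· * _) (G.range_mul_ghost (tailEdge L v n))

theorem tailGhost_mul_tailPath (x : (E.addTails L).Vertex) :
    tailGhost G x * tailPath G x = G.vert x := by
  induction x using addTails_vertex_induction with
  | h0 v => exact G.vert_mul_self _
  | h1 v n ih =>
    rw [tailGhost_succ, tailPath_succ, mul_assoc, ← mul_assoc (tailGhost G _), ih,
      ← source_tailEdge, G.source_mul_edge, G.ghost_mul_self, range_tailEdge]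

/-- The shorter path cancels, and the remaining stretch of tail begins with the tail edge at `vₘ`.
That edge is orthogonal to the edge replacing `eₘ`, which also starts at `vₘ`. -/
theorem tailGhost_mul_tailPath_of_lt (v : {v : E.Vertex // E.IsSingular v}) {m n : ℕ}
    (h : m < n) : ∃ y, tailGhost G (tailV L v m) * tailPath G (tailV L v n) =
      G.edge (tailEdge L v m) * y := by
  induction n, h using Nat.le_induction with
  | base =>
    refine ⟨1, ?_⟩
    rw [tailPath_succ, ← mul_assoc, tailGhost_mul_tailPath, mul_one, ← source_tailEdge,
      G.source_mul_edge]
  | succ n _ ih =>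
    obtain ⟨y, hy⟩ := ih
    exact ⟨y * G.edge (tailEdge L v n), by rw [tailPath_succ, ← mul_assoc, hy, mul_assoc]⟩

theorem tailGhost_mul_tailPath_of_gt (v : {v : E.Vertex // E.IsSingular v}) {m n : ℕ}
    (h : n < m) : ∃ y, tailGhost G (tailV L v m) * tailPath G (tailV L v n) =
      y * G.ghost (tailEdge L v n) := by
  induction m, h using Nat.le_induction with
  | base =>
    refine ⟨1, ?_⟩
    rw [tailGhost_succ, mul_assoc, tailGhost_mul_tailPath, one_mul, ← source_tailEdge,
      G.ghost_mul_source]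
  | succ m _ ih =>
    obtain ⟨y, hy⟩ := ih
    exact ⟨G.ghost (tailEdge L v m) * y, by rw [tailGhost_succ, mul_assoc, hy, mul_assoc]⟩

theorem tailGhost_mul_tailPath_of_ne {x y : (E.addTails L).Vertex}
    (h : tailBase L x ≠ tailBase L y) : tailGhost G x * tailPath G y = 0 := by
  rw [← tailGhost_mul_tailBase, ← tailBase_mul_tailPath G y, mul_assoc,
    ← mul_assoc (G.vert (addTailsVertex L (tailBase L x))), G.vert_mul_of_ne, zero_mul, mul_zero]
  exact fun h' => h (addTailsVertex_injective L h')

/-- For `m < n`, the path replacing `eₘ` leaves the tail at `vₘ`, whereas the one replacing `eₙ`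
continues along it. Neither is an initial segment of the other, so their product vanishes. -/
theorem ghost_mul_tailGhost_mul_of_ne {e f : E.Edge} (h : e ≠ f) :
    G.ghost (oldEdge L e) * (tailGhost G ((E.addTails L).source (oldEdge L e)) *
      tailPath G ((E.addTails L).source (oldEdge L f))) * G.edge (oldEdge L f) = 0 := by
  have hne : oldEdge L e ≠ oldEdge L f := fun h' => h (oldEdge_injective L h')
  by_cases hs : E.source e = E.source f
  · rcases isRegular_source_or_exists_listing L e with he | ⟨v, hv, m, rfl⟩
    · have h1 : (E.addTails L).source (oldEdge L e) = (E.addTails L).source (oldEdge L f) := by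
        rw [source_oldEdge_of_isRegular L he, source_oldEdge_of_isRegular L (hs ▸ he), hs]
      rw [h1, tailGhost_mul_tailPath, mul_assoc, G.source_mul_edge, G.ghost_mul_of_ne _ _ hne]
    · rw [source_listing] at hs
      obtain ⟨n, rfl⟩ : ∃ n, f = L v hv n :=
        ⟨(L v hv).symm ⟨f, hs.symm⟩, by rw [Equiv.apply_symm_apply]⟩
      rw [source_oldEdge_listing, source_oldEdge_listing]
      have hmn : m ≠ n := fun h' => h (by rw [h'])
      rcases lt_or_gt_of_ne hmn with hlt | hgt
      · obtain ⟨y, hy⟩ := tailGhost_mul_tailPath_of_lt G ⟨v, hv.isSingular⟩ hlt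
        rw [hy, ← mul_assoc, G.ghost_mul_of_ne _ _ (oldEdge_ne_tailEdge L _ _ _), zero_mul,
          zero_mul]
      · obtain ⟨y, hy⟩ := tailGhost_mul_tailPath_of_gt G ⟨v, hv.isSingular⟩ hgt
        rw [hy, mul_assoc, mul_assoc, G.ghost_mul_of_ne _ _ (oldEdge_ne_tailEdge L _ _ _).symm,
          mul_zero, mul_zero]
  · rw [tailGhost_mul_tailPath_of_ne, mul_zero, zero_mul]
    rwa [tailBase_source_oldEdge, tailBase_source_oldEdge]

/-- The Leavitt family of `E` obtained from a Leavitt family of the graph with tails: an edge of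
an infinite emitter is mapped to the product of the edges of the path that replaces it. -/
noncomputable def LeavittFamily.ofAddTails : LeavittFamily E R where
  vert v := G.vert (addTailsVertex L v)
  edge e := tailPath G ((E.addTails L).source (oldEdge L e)) * G.edge (oldEdge L e)
  ghost e := G.ghost (oldEdge L e) * tailGhost G ((E.addTails L).source (oldEdge L e))
  vert_mul_self v := G.vert_mul_self _
  vert_mul_of_ne v v' h := G.vert_mul_of_ne _ _ fun h' => h (addTailsVertex_injective L h')
  source_mul_edge e := by
    have := tailBase_mul_tailPath G ((E.addTails L).source (oldEdge L e))
    rw [tailBase_source_oldEdge] at this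
    rw [← mul_assoc, this]
  edge_mul_range e := by
    rw [mul_assoc, ← range_oldEdge, G.edge_mul_range]
  range_mul_ghost e := by
    rw [← mul_assoc, ← range_oldEdge, G.range_mul_ghost]
  ghost_mul_source e := by
    have := tailGhost_mul_tailBase G ((E.addTails L).source (oldEdge L e))
    rw [tailBase_source_oldEdge] at this
    rw [mul_assoc, this]
  ghost_mul_self e := by
    rw [mul_assoc, ← mul_assoc (tailGhost G _), tailGhost_mul_tailPath, G.source_mul_edge,
      G.ghost_mul_self, range_oldEdge]
  ghost_mul_of_ne e f h := by
    rw [← ghost_mul_tailGhost_mul_of_ne G h]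
    simp only [mul_assoc]
  -- The relation is only required at regular vertices of `E`. These carry no tail, so each path
  -- factor is the vertex itself and the relation is the one at `v` in the larger graph.
  vert_eq_sum v h := by
    have h' : (E.addTails L).IsRegular (addTailsVertex L v) := addTails_isRegular L _
    rw [G.vert_eq_sum _ h', addTails_sum_addTailsVertex h h']
    refine Finset.sum_congr rfl fun e he => ?_
    have hs : E.source e = v := by simpa [emitted] using he
    have h1 := source_oldEdge_of_isRegular L (e := e) (hs ▸ h)
    have h2 := G.source_mul_edge (oldEdge L e)
    have h3 := G.ghost_mul_source (oldEdge L e)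
    rw [h1] at h2 h3 ⊢
    rw [tailPath_addTailsVertex, tailGhost_addTailsVertex, h2, h3]

end TailPaths

/-! ### The image of `L(E)` is a corner -/

section TailCorner

variable {E : DirectedGraph.{u}} {L : E.EdgeListing} (K : Type w) [Field K]
  {R : Type*} [Ring R] [Algebra K R] (G : LeavittFamily (E.addTails L) R)

/-- The subalgebra generated by the family of `E` obtained from a family of the graph with
tails. -/
abbrev ofAddTailsSubalgebra : NonUnitalSubalgebra K R :=
  NonUnitalAlgebra.adjoin K (Set.range G.ofAddTails.gen)

theorem gen_mem_ofAddTailsSubalgebra (g : E.Generator) :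
    G.ofAddTails.gen g ∈ ofAddTailsSubalgebra K G :=
  NonUnitalAlgebra.subset_adjoin K ⟨g, rfl⟩

/-- By the second Cuntz-Krieger relation at `vₙ`, `pₙ₊₁pₙ₊₁*` is `pₙpₙ*` minus the image of `eₙeₙ*`;
at a sink nothing is subtracted. Induction starts from `p₀p₀* = v`. -/
theorem tailPath_mul_tailGhost_mem (x : (E.addTails L).Vertex) :
    tailPath G x * tailGhost G x ∈ ofAddTailsSubalgebra K G := by
  induction x using addTails_vertex_induction with
  | h0 v =>
    rw [tailPath_addTailsVertex, tailGhost_addTailsVertex, G.vert_mul_self]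
    exact gen_mem_ofAddTailsSubalgebra K G (.vertex v)
  | h1 v n ih =>
    have hr := addTails_isRegular L (tailV L v n)
    have h1 := G.vert_eq_sum _ hr
    rw [addTails_sum_tailV hr] at h1
    have h2 := eq_sub_of_add_eq h1.symm
    rw [tailPath_succ, tailGhost_succ, mul_assoc, ← mul_assoc (G.edge _), h2, sub_mul, mul_sub,
      ← mul_assoc, tailPath_mul_vert]
    refine sub_mem ih ?_
    split_ifs with h
    · have := mul_mem (gen_mem_ofAddTailsSubalgebra K G (.edge (L v h n)))
        (gen_mem_ofAddTailsSubalgebra K G (.ghost (L v h n)))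
      simp only [LeavittFamily.gen, LeavittFamily.ofAddTails, source_oldEdge_listing] at this
      simpa only [mul_assoc] using this
    · simp

theorem tailPath_mul_vert_of_ne {x y : (E.addTails L).Vertex} (h : x ≠ y) :
    tailPath G x * G.vert y = 0 := by
  rw [← tailPath_mul_vert, mul_assoc, G.vert_mul_of_ne _ _ h, mul_zero]

theorem vert_mul_tailGhost_of_ne {x y : (E.addTails L).Vertex} (h : x ≠ y) :
    G.vert x * tailGhost G y = 0 := by
  rw [← vert_mul_tailGhost, ← mul_assoc, G.vert_mul_of_ne _ _ h, zero_mul]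

/-- An element `z` supported between `y` and `y'` is killed by the paths ending at any other
vertices, so only the matching endpoints have to be checked. -/
theorem tailPath_mul_mul_tailGhost_mem {x x' y y' : (E.addTails L).Vertex} {z : R}
    (hz : G.vert y * z = z) (hz' : z * G.vert y' = z)
    (h : tailPath G y * z * tailGhost G y' ∈ ofAddTailsSubalgebra K G) :
    tailPath G x * z * tailGhost G x' ∈ ofAddTailsSubalgebra K G := by
  by_cases hx : x = y
  · by_cases hx' : y' = x'
    · rwa [hx, ← hx']
    · rw [← hz', mul_assoc, mul_assoc, vert_mul_tailGhost_of_ne G hx', mul_zero, mul_zero]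
      exact zero_mem _
  · rw [← hz, ← mul_assoc, tailPath_mul_vert_of_ne G hx, zero_mul, zero_mul]
    exact zero_mem _

theorem tailPath_mul_gen_mul_tailGhost_mem (g : (E.addTails L).Generator)
    (x x' : (E.addTails L).Vertex) :
    tailPath G x * G.gen g * tailGhost G x' ∈ ofAddTailsSubalgebra K G := by
  cases g with
  | vertex y =>
    change tailPath G x * G.vert y * tailGhost G x' ∈ _
    refine tailPath_mul_mul_tailGhost_mem K G (G.vert_mul_self y) (G.vert_mul_self y) ?_
    rw [tailPath_mul_vert]
    exact tailPath_mul_tailGhost_mem K G y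
  | edge e =>
    change tailPath G x * G.edge e * tailGhost G x' ∈ _
    refine tailPath_mul_mul_tailGhost_mem K G (G.source_mul_edge e) (G.edge_mul_range e) ?_
    rcases addTails_edge_cases L e with ⟨e, rfl⟩ | ⟨v, n, rfl⟩
    · rw [range_oldEdge, tailGhost_addTailsVertex, mul_assoc, ← range_oldEdge, G.edge_mul_range]
      exact gen_mem_ofAddTailsSubalgebra K G (.edge e)
    · rw [source_tailEdge, range_tailEdge, ← tailPath_succ]
      exact tailPath_mul_tailGhost_mem K G _
  | ghost e =>
    change tailPath G x * G.ghost e * tailGhost G x' ∈ _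
    refine tailPath_mul_mul_tailGhost_mem K G (G.range_mul_ghost e) (G.ghost_mul_source e) ?_
    rcases addTails_edge_cases L e with ⟨e, rfl⟩ | ⟨v, n, rfl⟩
    · rw [range_oldEdge, tailPath_addTailsVertex, ← range_oldEdge, G.range_mul_ghost]
      exact gen_mem_ofAddTailsSubalgebra K G (.ghost e)
    · rw [source_tailEdge, range_tailEdge, mul_assoc, ← tailGhost_succ]
      exact tailPath_mul_tailGhost_mem K G _

/-- This is the corner property in a form suited to induction: at vertices of `E` the paths reduce
to the vertices themselves, but products force arbitrary intermediate endpoints. -/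
theorem tailPath_mul_mem {y : (E.addTails L).UnitalLeavittAlgebra K}
    (hy : y ∈ unitalSubalgebra (E.addTails L) K) (x x' : (E.addTails L).Vertex) :
    tailPath ((E.addTails L).universalFamily K) x * y *
      tailGhost ((E.addTails L).universalFamily K) x' ∈
        ofAddTailsSubalgebra K ((E.addTails L).universalFamily K) := by
  set G := (E.addTails L).universalFamily K with hG
  induction hy using NonUnitalAlgebra.adjoin_induction generalizing x x' with
  | mem y hy =>
    obtain ⟨g, rfl⟩ := hy
    rw [← universalFamily_gen]
    exact tailPath_mul_gen_mul_tailGhost_mem K G g x x'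
  | add y z _ _ hy hz =>
    rw [mul_add, add_mul]
    exact add_mem (hy x x') (hz x x')
  | zero =>
    rw [mul_zero, zero_mul]
    exact zero_mem _
  | mul y z hy' _ hy hz =>
    -- A local unit `∑ w = ∑ p_w* p_w` inserted between `y` and `z` splits the product into products
    -- of elements already treated.
    obtain ⟨A, hA⟩ := exists_unitalVertexSum_mul hy'
    have h1 : tailPath G x * (y * z) * tailGhost G x' =
        ∑ w ∈ A, (tailPath G x * y * tailGhost G w) * (tailPath G w * z * tailGhost G x') := by
      conv_lhs => rw [← (hA A subset_rfl).2, unitalVertexSum]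
      simp only [Finset.mul_sum, Finset.sum_mul]
      refine Finset.sum_congr rfl fun w _ => ?_
      rw [← hG, ← tailGhost_mul_tailPath]
      simp only [mul_assoc]
    rw [h1]
    exact sum_mem fun w _ => mul_mem (hy x w) (hz w x')
  | smul k y _ hy =>
    rw [mul_smul_comm, smul_mul_assoc]
    exact SMulMemClass.smul_mem k (hy x x')

end TailCorner

/-! ### Injectivity -/

section TailMatrix

variable {E : DirectedGraph.{u}} (L : E.EdgeListing) {R : Type*} [Ring R]
  (H : LeavittFamily E R)

open Classical in
/-- The projection `eₙ eₙ*` to the `n`-th edge of an infinite emitter. -/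
noncomputable def listingProj (v : {v : E.Vertex // E.IsSingular v}) (n : ℕ) : R :=
  if h : E.IsInfiniteEmitter v then H.edge (L v h n) * H.ghost (L v h n) else 0

/-- The element `v - e₀e₀* - ⋯ - eₙ₋₁eₙ₋₁*` at the vertex `vₙ`. -/
noncomputable def tailProj : (E.addTails L).Vertex → R :=
  tailRec L H.vert fun v n x => x - listingProj L H v n

/-- A function on the edges of the graph with tails. -/
def edgeRec {α : Type*} (f : E.Edge → α) (g : {v : E.Vertex // E.IsSingular v} → ℕ → α) :
    (E.addTails L).Edge → α
  | .inl e => f e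
  | .inr (v, n) => g v n

@[simp] theorem edgeRec_oldEdge {α : Type*} (f : E.Edge → α)
    (g : {v : E.Vertex // E.IsSingular v} → ℕ → α) (e : E.Edge) :
    edgeRec L f g (oldEdge L e) = f e := rfl

@[simp] theorem edgeRec_tailEdge {α : Type*} (f : E.Edge → α)
    (g : {v : E.Vertex // E.IsSingular v} → ℕ → α) (v n) :
    edgeRec L f g (tailEdge L v n) = g v n := rfl

@[simp] theorem tailProj_addTailsVertex (v : E.Vertex) :
    tailProj L H (addTailsVertex L v) = H.vert v := rfl

theorem tailProj_succ (v : {v : E.Vertex // E.IsSingular v}) (n : ℕ) :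
    tailProj L H (tailV L v (n + 1)) = tailProj L H (tailV L v n) - listingProj L H v n :=
  tailRec_succ L _ _ v n

/-- Only the projections `eᵢeᵢ*` with `i < m ≤ n` have been subtracted, and these annihilate `eₙ`.
-/
theorem tailProj_mul_listing {v : E.Vertex} (h : E.IsInfiniteEmitter v) {m n : ℕ} (hmn : m ≤ n) :
    tailProj L H (tailV L ⟨v, h.isSingular⟩ m) * H.edge (L v h n) = H.edge (L v h n) := by
  induction m with
  | zero =>
    rw [tailV_zero, tailProj_addTailsVertex]
    have := H.source_mul_edge (L v h n)
    rwa [source_listing] at this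
  | succ m ih =>
    have hne : (L v h m : E.Edge) ≠ L v h n := fun h' =>
      (Nat.lt_of_succ_le hmn).ne ((L v h).injective (Subtype.ext h'))
    rw [tailProj_succ, sub_mul, ih (Nat.le_of_succ_le hmn), listingProj, dif_pos h, mul_assoc,
      H.ghost_mul_of_ne _ _ hne, mul_zero, sub_zero]

theorem listing_mul_tailProj {v : E.Vertex} (h : E.IsInfiniteEmitter v) {m n : ℕ} (hmn : m ≤ n) :
    H.ghost (L v h n) * tailProj L H (tailV L ⟨v, h.isSingular⟩ m) = H.ghost (L v h n) := by
  induction m with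
  | zero =>
    rw [tailV_zero, tailProj_addTailsVertex]
    have := H.ghost_mul_source (L v h n)
    rwa [source_listing] at this
  | succ m ih =>
    have hne : (L v h n : E.Edge) ≠ L v h m := fun h' =>
      (Nat.lt_of_succ_le hmn).ne' ((L v h).injective (Subtype.ext h'))
    rw [tailProj_succ, mul_sub, ih (Nat.le_of_succ_le hmn), listingProj, dif_pos h, ← mul_assoc,
      H.ghost_mul_of_ne _ _ hne, zero_mul, sub_zero]

theorem ghost_mul_edge_mul_ghost (e : E.Edge) :
    H.ghost e * (H.edge e * H.ghost e) = H.ghost e := by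
  rw [← mul_assoc, H.ghost_mul_self, H.range_mul_ghost]

theorem edge_mul_ghost_mul_edge (e : E.Edge) :
    H.edge e * H.ghost e * H.edge e = H.edge e := by
  rw [mul_assoc, H.ghost_mul_self, H.edge_mul_range]

theorem tailProj_mul_listingProj (v : {v : E.Vertex // E.IsSingular v}) (n : ℕ) :
    tailProj L H (tailV L v n) * listingProj L H v n = listingProj L H v n := by
  rw [listingProj]
  split_ifs with h
  · rw [← mul_assoc, tailProj_mul_listing L H h le_rfl]
  · exact mul_zero _

theorem listingProj_mul_tailProj (v : {v : E.Vertex // E.IsSingular v}) (n : ℕ) :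
    listingProj L H v n * tailProj L H (tailV L v n) = listingProj L H v n := by
  rw [listingProj]
  split_ifs with h
  · rw [mul_assoc, listing_mul_tailProj L H h le_rfl]
  · exact zero_mul _

theorem listingProj_mul_self (v : {v : E.Vertex // E.IsSingular v}) (n : ℕ) :
    listingProj L H v n * listingProj L H v n = listingProj L H v n := by
  rw [listingProj]
  split_ifs with h
  · rw [← mul_assoc, edge_mul_ghost_mul_edge]
  · exact mul_zero _

theorem tailProj_mul_self (x : (E.addTails L).Vertex) :
    tailProj L H x * tailProj L H x = tailProj L H x := by
  induction x using addTails_vertex_induction with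
  | h0 v => exact H.vert_mul_self v
  | h1 v n ih =>
    rw [tailProj_succ, mul_sub, sub_mul, sub_mul, ih, tailProj_mul_listingProj,
      listingProj_mul_tailProj, listingProj_mul_self, sub_self, sub_zero]

theorem tailProj_mul_succ (v : {v : E.Vertex // E.IsSingular v}) (n : ℕ) :
    tailProj L H (tailV L v n) * tailProj L H (tailV L v (n + 1)) =
      tailProj L H (tailV L v (n + 1)) := by
  rw [tailProj_succ, mul_sub, tailProj_mul_self, tailProj_mul_listingProj]

theorem tailProj_succ_mul (v : {v : E.Vertex // E.IsSingular v}) (n : ℕ) :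
    tailProj L H (tailV L v (n + 1)) * tailProj L H (tailV L v n) =
      tailProj L H (tailV L v (n + 1)) := by
  rw [tailProj_succ, sub_mul, tailProj_mul_self, listingProj_mul_tailProj]

/-- The matrix family of the graph with tails given by a Leavitt family of `E`. -/
noncomputable def tailMatrixFamily : MatrixFamily (E.addTails L) R where
  p := tailProj L H
  -- Let `qₙ` be the coefficient of `vₙ`. The tail edge acts through the smaller projection `qₙ₊₁ ≤
  -- qₙ`, so the second Cuntz-Krieger relation at `vₙ` becomes `qₙ = qₙ₊₁ + eₙeₙ*`, or `qₙ = qₙ₊₁`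
  -- at a sink.
  c := edgeRec L H.edge fun v n => tailProj L H (tailV L v (n + 1))
  d := edgeRec L H.ghost fun v n => tailProj L H (tailV L v (n + 1))
  p_mul_self := tailProj_mul_self L H
  p_mul_c e := by
    rcases addTails_edge_cases L e with ⟨e, rfl⟩ | ⟨v, n, rfl⟩
    · rw [edgeRec_oldEdge]
      rcases isRegular_source_or_exists_listing L e with h | ⟨v, h, n, rfl⟩
      · rw [source_oldEdge_of_isRegular L h, tailProj_addTailsVertex, H.source_mul_edge]
      · rw [source_oldEdge_listing, tailProj_mul_listing L H h le_rfl]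
    · rw [edgeRec_tailEdge, source_tailEdge, tailProj_mul_succ]
  c_mul_p e := by
    rcases addTails_edge_cases L e with ⟨e, rfl⟩ | ⟨v, n, rfl⟩
    · rw [edgeRec_oldEdge, range_oldEdge, tailProj_addTailsVertex, H.edge_mul_range]
    · rw [edgeRec_tailEdge, range_tailEdge, tailProj_mul_self]
  p_mul_d e := by
    rcases addTails_edge_cases L e with ⟨e, rfl⟩ | ⟨v, n, rfl⟩
    · rw [edgeRec_oldEdge, range_oldEdge, tailProj_addTailsVertex, H.range_mul_ghost]
    · rw [edgeRec_tailEdge, range_tailEdge, tailProj_mul_self]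
  d_mul_p e := by
    rcases addTails_edge_cases L e with ⟨e, rfl⟩ | ⟨v, n, rfl⟩
    · rw [edgeRec_oldEdge]
      rcases isRegular_source_or_exists_listing L e with h | ⟨v, h, n, rfl⟩
      · rw [source_oldEdge_of_isRegular L h, tailProj_addTailsVertex, H.ghost_mul_source]
      · rw [source_oldEdge_listing, listing_mul_tailProj L H h le_rfl]
    · rw [edgeRec_tailEdge, source_tailEdge, tailProj_succ_mul]
  d_mul_c e := by
    rcases addTails_edge_cases L e with ⟨e, rfl⟩ | ⟨v, n, rfl⟩
    · rw [edgeRec_oldEdge, edgeRec_oldEdge, H.ghost_mul_self, range_oldEdge,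
        tailProj_addTailsVertex]
    · rw [edgeRec_tailEdge, edgeRec_tailEdge, range_tailEdge, tailProj_mul_self]
  d_mul_c_of_ne e f hne hs := by
    rcases addTails_edge_cases L e with ⟨e, rfl⟩ | ⟨v, n, rfl⟩
    · rcases addTails_edge_cases L f with ⟨f, rfl⟩ | ⟨v, n, rfl⟩
      · exact H.ghost_mul_of_ne e f fun h => hne (h ▸ rfl)
      · rcases (addTails_mem_emitted_tailV L).1 hs with h | ⟨h, he⟩
        · exact absurd h (oldEdge_ne_tailEdge L _ _ _)
        · rw [he, edgeRec_oldEdge, edgeRec_tailEdge, tailProj_succ, mul_sub,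
            listing_mul_tailProj L H h le_rfl, listingProj, dif_pos h, ghost_mul_edge_mul_ghost,
            sub_self]
    · rcases (addTails_mem_emitted_tailV L).1 hs.symm with h | ⟨h, hf⟩
      · exact absurd h.symm hne
      · rw [hf, edgeRec_oldEdge, edgeRec_tailEdge, tailProj_succ, sub_mul,
          tailProj_mul_listing L H h le_rfl, listingProj, dif_pos h, edge_mul_ghost_mul_edge,
          sub_self]
  p_eq_sum x hr := by
    rcases addTails_vertex_cases L x with ⟨v, hv, rfl⟩ | ⟨v, n, rfl⟩
    · rw [addTails_sum_addTailsVertex hv hr]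
      exact H.vert_eq_sum v hv
    · rw [addTails_sum_tailV hr]
      simp only [edgeRec_tailEdge, edgeRec_oldEdge]
      rw [tailProj_mul_self, tailProj_succ, listingProj, sub_add_cancel]

variable (K : Type w) [Field K] [Algebra K R]

theorem tailPath_tailMatrixFamily (x : (E.addTails L).Vertex) :
    tailPath ((tailMatrixFamily L H).toLeavittFamily K) x =
      matUnit K (addTailsVertex L (tailBase L x)) x (tailProj L H x) := by
  induction x using addTails_vertex_induction with
  | h0 v => rfl
  | h1 v n ih =>
    rw [tailPath_succ, ih, tailBase_tailV, tailBase_tailV]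
    refine (matUnit_mul _ _ _ _ _).trans (congrArg _ ?_)
    exact tailProj_mul_succ L H v n

theorem tailGhost_tailMatrixFamily (x : (E.addTails L).Vertex) :
    tailGhost ((tailMatrixFamily L H).toLeavittFamily K) x =
      matUnit K x (addTailsVertex L (tailBase L x)) (tailProj L H x) := by
  induction x using addTails_vertex_induction with
  | h0 v => rfl
  | h1 v n ih =>
    rw [tailGhost_succ, ih, tailBase_tailV, tailBase_tailV]
    refine (matUnit_mul _ _ _ _ _).trans (congrArg _ ?_)
    exact tailProj_succ_mul L H v n

/-- The path along the tail contributes only `qₙ`, and `qₙeₙ = eₙ`; hence the path that replaces an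
edge acts by the edge itself, between vertices of `E`. -/
theorem ofAddTails_tailMatrixFamily_edge (e : E.Edge) :
    ((tailMatrixFamily L H).toLeavittFamily K).ofAddTails.edge e =
      matUnit K (addTailsVertex L (E.source e)) (addTailsVertex L (E.range e)) (H.edge e) := by
  change tailPath _ _ * _ = _
  rw [tailPath_tailMatrixFamily, tailBase_source_oldEdge]
  exact (matUnit_mul _ _ _ _ _).trans (congrArg _ ((tailMatrixFamily L H).p_mul_c (oldEdge L e)))

theorem ofAddTails_tailMatrixFamily_ghost (e : E.Edge) :
    ((tailMatrixFamily L H).toLeavittFamily K).ofAddTails.ghost e =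
      matUnit K (addTailsVertex L (E.range e)) (addTailsVertex L (E.source e)) (H.ghost e) := by
  change _ * tailGhost _ _ = _
  rw [tailGhost_tailMatrixFamily, tailBase_source_oldEdge]
  exact (matUnit_mul _ _ _ _ _).trans (congrArg _ ((tailMatrixFamily L H).d_mul_p (oldEdge L e)))

end TailMatrix

/-! ### The embedding of `L(E)` as a full corner -/

section TailHom

theorem tailPath_map {E : DirectedGraph.{u}} {L : E.EdgeListing} {R R' : Type*} [Ring R] [Ring R']
    (G : LeavittFamily (E.addTails L) R) (G' : LeavittFamily (E.addTails L) R') (f : R →+* R')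
    (h : ∀ g, f (G.gen g) = G'.gen g) (x : (E.addTails L).Vertex) :
    f (tailPath G x) = tailPath G' x := by
  induction x using addTails_vertex_induction with
  | h0 v => exact h (.vertex _)
  | h1 v n ih =>
    rw [tailPath_succ, tailPath_succ, map_mul, ih]
    exact congrArg _ (h (.edge _))

theorem tailGhost_map {E : DirectedGraph.{u}} {L : E.EdgeListing} {R R' : Type*} [Ring R] [Ring R']
    (G : LeavittFamily (E.addTails L) R) (G' : LeavittFamily (E.addTails L) R') (f : R →+* R')
    (h : ∀ g, f (G.gen g) = G'.gen g) (x : (E.addTails L).Vertex) :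
    f (tailGhost G x) = tailGhost G' x := by
  induction x using addTails_vertex_induction with
  | h0 v => exact h (.vertex _)
  | h1 v n ih =>
    rw [tailGhost_succ, tailGhost_succ, map_mul, ih]
    exact congrArg (· * _) (h (.ghost _))

theorem ofAddTails_gen_map {E : DirectedGraph.{u}} {L : E.EdgeListing} {R R' : Type*} [Ring R]
    [Ring R'] (G : LeavittFamily (E.addTails L) R) (G' : LeavittFamily (E.addTails L) R')
    (f : R →+* R') (h : ∀ g, f (G.gen g) = G'.gen g) (g : E.Generator) :
    f (G.ofAddTails.gen g) = G'.ofAddTails.gen g := by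
  cases g with
  | vertex v => exact h (.vertex _)
  | edge e =>
    exact (map_mul f _ _).trans (congrArg₂ (· * ·) (tailPath_map G G' f h _) (h (.edge _)))
  | ghost e =>
    exact (map_mul f _ _).trans (congrArg₂ (· * ·) (h (.ghost _)) (tailGhost_map G G' f h _))

variable (K : Type w) [Field K] {E : DirectedGraph.{u}} (L : E.EdgeListing)

/-- The homomorphism from the Leavitt path algebra of `E` to that of the graph with tails, for
the algebras with unit. -/
noncomputable def unitalTailHom :
    E.UnitalLeavittAlgebra K →ₐ[K] (E.addTails L).UnitalLeavittAlgebra K :=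
  ((E.addTails L).universalFamily K).ofAddTails.lift K

theorem unitalTailHom_generator (g : E.Generator) :
    unitalTailHom K L (E.unitalGenerator K g) =
      ((E.addTails L).universalFamily K).ofAddTails.gen g :=
  LeavittFamily.lift_generator K _ g

open Classical in
/-- The embedding of the regular module as the columns supported on the vertices of `E`. -/
noncomputable def columnEmb {R : Type*} [Ring R] [Algebra K R] (H : LeavittFamily E R) :
    R →ₗ[K] ((E.addTails L).Vertex → R) :=
  LinearMap.pi fun x => LinearMap.mulLeft K
    (if x = addTailsVertex L (tailBase L x) then H.vert (tailBase L x) else 0)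

variable {R : Type*} [Ring R] [Algebra K R] (H : LeavittFamily E R)

theorem columnEmb_addTailsVertex (r : R) (v : E.Vertex) :
    columnEmb K L H r (addTailsVertex L v) = H.vert v * r := by
  simp [columnEmb]

theorem columnEmb_of_ne (r : R) {x : (E.addTails L).Vertex}
    (h : x ≠ addTailsVertex L (tailBase L x)) : columnEmb K L H r x = 0 := by
  simp [columnEmb, h]

theorem matUnit_columnEmb {v w : E.Vertex} {a : R} (h1 : H.vert v * a = a)
    (h2 : a * H.vert w = a) (r : R) :
    matUnit K (addTailsVertex L v) (addTailsVertex L w) a (columnEmb K L H r) =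
      columnEmb K L H (a * r) := by
  funext x
  by_cases hx : x = addTailsVertex L (tailBase L x)
  · rw [hx, columnEmb_addTailsVertex]
    by_cases hv : tailBase L x = v
    · rw [hv, matUnit_apply_self, columnEmb_addTailsVertex, ← mul_assoc, ← mul_assoc, h1, h2]
    · rw [matUnit_apply_of_ne fun h => hv (addTailsVertex_injective L h), ← h1, ← mul_assoc,
        ← mul_assoc, H.vert_mul_of_ne _ _ hv, zero_mul, zero_mul]
  · rw [columnEmb_of_ne K L H _ hx, matUnit_apply_of_ne]
    rintro rfl
    exact hx rfl

theorem ofAddTails_gen_columnEmb (g : E.Generator) (r : R) :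
    ((tailMatrixFamily L H).toLeavittFamily K).ofAddTails.gen g (columnEmb K L H r) =
      columnEmb K L H (H.gen g * r) := by
  cases g with
  | vertex v => exact matUnit_columnEmb K L H (H.vert_mul_self v) (H.vert_mul_self v) r
  | edge e =>
    refine (congrArg (fun T => T (columnEmb K L H r))
      (ofAddTails_tailMatrixFamily_edge L H K e)).trans ?_
    exact matUnit_columnEmb K L H (H.source_mul_edge e) (H.edge_mul_range e) r
  | ghost e =>
    refine (congrArg (fun T => T (columnEmb K L H r))
      (ofAddTails_tailMatrixFamily_ghost L H K e)).trans ?_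
    exact matUnit_columnEmb K L H (H.range_mul_ghost e) (H.ghost_mul_source e) r

/-- The matrix representation restricted along `L(E) → L(F)` preserves the embedded column, on which
it is left multiplication. Evaluating it at `1` recovers the original element from its image. -/
theorem lift_unitalTailHom_columnEmb {x : E.UnitalLeavittAlgebra K}
    (hx : x ∈ unitalSubalgebra E K) (r : E.UnitalLeavittAlgebra K) :
    ((tailMatrixFamily L (E.universalFamily K)).toLeavittFamily K).lift K (unitalTailHom K L x)
        (columnEmb K L (E.universalFamily K) r) =
      columnEmb K L (E.universalFamily K) (x * r) := by
  induction hx using NonUnitalAlgebra.adjoin_induction generalizing r with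
  | mem x hx =>
    obtain ⟨g, rfl⟩ := hx
    rw [unitalTailHom_generator, ← universalFamily_gen, ← ofAddTails_gen_columnEmb]
    refine LinearMap.congr_fun ?_ (columnEmb K L (E.universalFamily K) r)
    refine ofAddTails_gen_map _ _
      (((tailMatrixFamily L (E.universalFamily K)).toLeavittFamily K).lift K).toRingHom
      (fun g' => ?_) g
    rw [universalFamily_gen]
    exact LeavittFamily.lift_generator K _ g'
  | add x y _ _ hx hy => rw [map_add, map_add, LinearMap.add_apply, hx, hy, add_mul, map_add]
  | zero => simp
  | mul x y _ _ hx hy => rw [map_mul, map_mul, Module.End.mul_apply, hy, hx, mul_assoc]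
  | smul k x _ hx =>
    rw [map_smul, map_smul, LinearMap.smul_apply, hx, smul_mul_assoc, map_smul]

/-- The entries of the column of `x` are the products `v x`, and finitely many of them sum to `x`
because `x` has a local unit. -/
theorem unitalTailHom_injOn {x : E.UnitalLeavittAlgebra K} (hx : x ∈ unitalSubalgebra E K)
    (h : unitalTailHom K L x = 0) : x = 0 := by
  have h1 := lift_unitalTailHom_columnEmb K L hx 1
  rw [h, map_zero, LinearMap.zero_apply, mul_one] at h1
  obtain ⟨A, hA⟩ := exists_unitalVertexSum_mul hx
  rw [← (hA A subset_rfl).1, unitalVertexSum, Finset.sum_mul]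
  refine Finset.sum_eq_zero fun v _ => ?_
  rw [← columnEmb_addTailsVertex K L, ← h1]; rfl

theorem tailPath_mem (x : (E.addTails L).Vertex) :
    tailPath ((E.addTails L).universalFamily K) x ∈ unitalSubalgebra (E.addTails L) K := by
  induction x using addTails_vertex_induction with
  | h0 v => exact NonUnitalAlgebra.subset_adjoin K ⟨_, rfl⟩
  | h1 v n ih =>
    rw [tailPath_succ]
    exact mul_mem ih (NonUnitalAlgebra.subset_adjoin K ⟨_, rfl⟩)

theorem tailGhost_mem (x : (E.addTails L).Vertex) :
    tailGhost ((E.addTails L).universalFamily K) x ∈ unitalSubalgebra (E.addTails L) K := by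
  induction x using addTails_vertex_induction with
  | h0 v => exact NonUnitalAlgebra.subset_adjoin K ⟨_, rfl⟩
  | h1 v n ih =>
    rw [tailGhost_succ]
    exact mul_mem (NonUnitalAlgebra.subset_adjoin K ⟨_, rfl⟩) ih

theorem unitalTailHom_mem {x : E.UnitalLeavittAlgebra K} (hx : x ∈ unitalSubalgebra E K) :
    unitalTailHom K L x ∈ unitalSubalgebra (E.addTails L) K := by
  induction hx using NonUnitalAlgebra.adjoin_induction with
  | mem x hx =>
    obtain ⟨g, rfl⟩ := hx
    rw [unitalTailHom_generator]
    cases g with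
    | vertex v => exact NonUnitalAlgebra.subset_adjoin K ⟨_, rfl⟩
    | edge e => exact mul_mem (tailPath_mem K L _) (NonUnitalAlgebra.subset_adjoin K ⟨_, rfl⟩)
    | ghost e => exact mul_mem (NonUnitalAlgebra.subset_adjoin K ⟨_, rfl⟩) (tailGhost_mem K L _)
  | add x y _ _ hx hy => rw [map_add]; exact add_mem hx hy
  | zero => rw [map_zero]; exact zero_mem _
  | mul x y _ _ hx hy => rw [map_mul]; exact mul_mem hx hy
  | smul k x _ hx => rw [map_smul]; exact SMulMemClass.smul_mem k hx

/-- The homomorphism from the Leavitt path algebra of `E` to that of the graph with tails. -/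
noncomputable def tailHom : E.LeavittPathAlgebra K →ₙₐ[K] (E.addTails L).LeavittPathAlgebra K where
  toFun x := ⟨unitalTailHom K L x, unitalTailHom_mem K L x.2⟩
  map_smul' k x := Subtype.ext (map_smul (unitalTailHom K L) k (x : E.UnitalLeavittAlgebra K))
  map_zero' := Subtype.ext (map_zero (unitalTailHom K L))
  map_add' x y := Subtype.ext (map_add (unitalTailHom K L) (x : E.UnitalLeavittAlgebra K) y)
  map_mul' x y := Subtype.ext (map_mul (unitalTailHom K L) (x : E.UnitalLeavittAlgebra K) y)

theorem coe_tailHom (x : E.LeavittPathAlgebra K) :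
    (tailHom K L x : (E.addTails L).UnitalLeavittAlgebra K) = unitalTailHom K L x := rfl

theorem tailHom_injective : Function.Injective (tailHom K L) :=
  (injective_iff_map_eq_zero _).2 fun x hx =>
    Subtype.ext (unitalTailHom_injOn K L x.2 (congrArg Subtype.val hx))

theorem tailHom_leavittVertex (v : E.Vertex) :
    tailHom K L (E.leavittVertex K v) =
      (E.addTails L).leavittVertex K (addTailsVertex L v) :=
  Subtype.ext (unitalTailHom_generator K L (.vertex v))

theorem exists_tailHom_eq {z : (E.addTails L).UnitalLeavittAlgebra K}
    (hz : z ∈ ofAddTailsSubalgebra K ((E.addTails L).universalFamily K)) :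
    ∃ c, (tailHom K L c : (E.addTails L).UnitalLeavittAlgebra K) = z := by
  induction hz using NonUnitalAlgebra.adjoin_induction with
  | mem z hz =>
    obtain ⟨g, rfl⟩ := hz
    exact ⟨⟨_, NonUnitalAlgebra.subset_adjoin K ⟨g, rfl⟩⟩, unitalTailHom_generator K L g⟩
  | add x y _ _ hx hy =>
    obtain ⟨a, rfl⟩ := hx
    obtain ⟨b, rfl⟩ := hy
    exact ⟨a + b, by rw [map_add]; rfl⟩
  | zero => exact ⟨0, by rw [map_zero]; rfl⟩
  | mul x y _ _ hx hy =>
    obtain ⟨a, rfl⟩ := hx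
    obtain ⟨b, rfl⟩ := hy
    exact ⟨a * b, by rw [map_mul]; rfl⟩
  | smul k x _ hx =>
    obtain ⟨a, rfl⟩ := hx
    exact ⟨k • a, by rw [map_smul]; rfl⟩

/-- The two-sided product is a finite sum of terms `v b w` with `v` and `w` vertices of `E`.
Allowing different sets on the two sides covers the local units of two unrelated elements. -/
theorem exists_tailHom_eq_corner (A A' : Finset E.Vertex)
    (b : (E.addTails L).LeavittPathAlgebra K) :
    ∃ c, tailHom K L c = tailHom K L (E.vertexSum K A) * b * tailHom K L (E.vertexSum K A') := by
  have hsum : ∀ A : Finset E.Vertex, unitalTailHom K L (E.unitalVertexSum K A) =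
      ∑ v ∈ A, tailPath ((E.addTails L).universalFamily K) (addTailsVertex L v) := fun A => by
    rw [unitalVertexSum, map_sum]
    exact Finset.sum_congr rfl fun v _ => unitalTailHom_generator K L (.vertex v)
  have hmem : unitalTailHom K L (E.unitalVertexSum K A) * b *
      unitalTailHom K L (E.unitalVertexSum K A') ∈
        ofAddTailsSubalgebra K ((E.addTails L).universalFamily K) := by
    rw [hsum, hsum]
    simp only [Finset.sum_mul, Finset.mul_sum]
    exact sum_mem fun v _ => sum_mem fun w _ =>
      tailPath_mul_mem K b.2 (addTailsVertex L w) (addTailsVertex L v)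
  obtain ⟨c, hc⟩ := exists_tailHom_eq K L hmem
  refine ⟨c, Subtype.ext (hc.trans ?_)⟩
  rw [← coe_vertexSum, ← coe_vertexSum, ← coe_tailHom, ← coe_tailHom]; rfl

/-- The homomorphism of rings underlying `tailHom`. -/
noncomputable def tailRingHom : E.LeavittPathAlgebra K →ₙ+* (E.addTails L).LeavittPathAlgebra K :=
  (tailHom K L : E.LeavittPathAlgebra K →ₙ+* (E.addTails L).LeavittPathAlgebra K)

theorem isFullCorner_tailHom :
    IsFullCorner (A := E.LeavittPathAlgebra K) (B := (E.addTails L).LeavittPathAlgebra K)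
      (tailRingHom K L) where
  localUnits := hasLocalUnits_leavittPathAlgebra E K
  localUnits' := hasLocalUnits_leavittPathAlgebra (E.addTails L) K
  injective := tailHom_injective K L
  corner a b a' := by
    obtain ⟨A, hA⟩ := exists_vertexSum_mul {a}
    obtain ⟨A', hA'⟩ := exists_vertexSum_mul {a'}
    obtain ⟨c, hc⟩ := exists_tailHom_eq_corner K L A A' b
    refine ⟨a * c * a', ?_⟩
    change tailHom K L (a * c * a') = tailHom K L a * b * tailHom K L a'
    rw [map_mul, map_mul, hc]
    have h1 : tailHom K L a * tailHom K L (E.vertexSum K A) = tailHom K L a := by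
      rw [← map_mul, (hA a (by simp)).2]
    have h2 : tailHom K L (E.vertexSum K A') * tailHom K L a' = tailHom K L a' := by
      rw [← map_mul, (hA' a' (by simp)).1]
    rw [mul_assoc, mul_assoc, h2, ← mul_assoc, ← mul_assoc, h1]
  full b := by
    obtain ⟨A, hA⟩ := exists_vertexSum_mul {b}
    let P : (E.addTails L).Vertex → (E.addTails L).LeavittPathAlgebra K :=
      fun x => ⟨_, tailPath_mem K L x⟩
    let Q : (E.addTails L).Vertex → (E.addTails L).LeavittPathAlgebra K :=
      fun x => ⟨_, tailGhost_mem K L x⟩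
    -- Each vertex factors as `pₓ* v pₓ` through the base `v` of its tail, so a local unit of `b`
    -- lies in the ideal generated by the image.
    have h1 : ∀ x, (E.addTails L).leavittVertex K x =
        Q x * tailHom K L (E.leavittVertex K (tailBase L x)) * P x := fun x => by
      rw [tailHom_leavittVertex]
      refine Subtype.ext ?_
      change _ = tailGhost _ x * ((E.addTails L).universalFamily K).vert _ * tailPath _ x
      rw [tailGhost_mul_tailBase, tailGhost_mul_tailPath]; rfl
    rw [← (hA b (by simp)).2, vertexSum, Finset.mul_sum]
    refine sum_mem fun x _ => AddSubgroup.subset_closure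
      ⟨b * Q x, E.leavittVertex K (tailBase L x), P x, ?_⟩
    rw [h1, mul_assoc, mul_assoc, mul_assoc]; rfl

theorem image_cornerSet (A : Finset E.Vertex) :
    tailHom K L '' cornerSet (E.vertexSum K A) = cornerSet (tailHom K L (E.vertexSum K A)) := by
  have hidem : E.vertexSum K A * E.vertexSum K A = E.vertexSum K A :=
    Subtype.ext (by
      have h := unitalVertexSum_mul_self (K := K) A
      rw [← coe_vertexSum] at h
      exact h)
  ext y
  constructor
  · rintro ⟨_, ⟨a, rfl⟩, rfl⟩
    exact ⟨tailHom K L a, by rw [map_mul, map_mul]⟩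
  · rintro ⟨b, rfl⟩
    obtain ⟨c, hc⟩ := exists_tailHom_eq_corner K L A A b
    refine ⟨E.vertexSum K A * c * E.vertexSum K A, ⟨c, rfl⟩, ?_⟩
    rw [map_mul, map_mul, hc]
    have h : tailHom K L (E.vertexSum K A) * tailHom K L (E.vertexSum K A) =
        tailHom K L (E.vertexSum K A) := by rw [← map_mul, hidem]
    simp only [mul_assoc, h]
    rw [← mul_assoc, h]

theorem isDesingularization_addTails : IsDesingularization K E (E.addTails L) where
  not_singular x hx := hx (addTails_isRegular L x)
  morita := (isFullCorner_tailHom K L).moritaEquivalent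

end TailHom

/-! ### Countability of corners -/

section Monomials

variable {E : DirectedGraph.{u}} {R : Type*} [Ring R] (G : LeavittFamily E R)

/-- The product of the edges in a list. -/
def LeavittFamily.edgeProd : List E.Edge → R
  | [] => 1
  | e :: l => G.edge e * LeavittFamily.edgeProd l

/-- The product of the ghost edges in a list, in the reverse order. -/
def LeavittFamily.ghostProd : List E.Edge → R
  | [] => 1
  | e :: l => LeavittFamily.ghostProd l * G.ghost e

theorem LeavittFamily.ghostProd_concat (l : List E.Edge) (e : E.Edge) :
    G.ghostProd (l ++ [e]) = G.ghost e * G.ghostProd l := by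
  induction l with
  | nil => simp [LeavittFamily.ghostProd]
  | cons f l ih => rw [List.cons_append, LeavittFamily.ghostProd, ih, mul_assoc]; rfl

/-- The monomial `α w β*`. -/
def LeavittFamily.monomial (m : List E.Edge × E.Vertex × List E.Edge) : R :=
  G.edgeProd m.1 * G.vert m.2.1 * G.ghostProd m.2.2

variable (K : Type w) [Field K] [Algebra K R]

/-- The span of the monomials `α w β*`. -/
def LeavittFamily.monomialSpan : Submodule K R := Submodule.span K (Set.range G.monomial)

theorem LeavittFamily.monomial_mem (m) : G.monomial m ∈ G.monomialSpan K :=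
  Submodule.subset_span ⟨m, rfl⟩

theorem LeavittFamily.vert_mul_monomial_mem (v : E.Vertex) (m) :
    G.vert v * G.monomial m ∈ G.monomialSpan K := by
  classical
  obtain ⟨α, w, β⟩ := m
  have h0 := G.monomial_mem K ⟨α, w, β⟩
  cases α with
  | nil =>
    simp only [LeavittFamily.monomial, LeavittFamily.edgeProd, one_mul] at h0 ⊢
    rw [← mul_assoc, G.vert_mul_vert]
    split_ifs with h
    · rwa [h]
    · rw [zero_mul]; exact zero_mem _
  | cons e α =>
    simp only [LeavittFamily.monomial, LeavittFamily.edgeProd] at h0 ⊢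
    by_cases h : v = E.source e
    · simp only [← mul_assoc] at h0 ⊢
      rwa [h, G.source_mul_edge]
    · rw [← G.source_mul_edge]
      simp only [← mul_assoc]
      rw [G.vert_mul_of_ne _ _ h]
      simp

/-- A ghost edge either cancels against the first edge of `α`, leaving a vertex or zero, or, when
`α` is empty, is absorbed into `β*`. The lists need not be paths: those that do not compose only add
zero to the spanning set. -/
theorem LeavittFamily.gen_mul_monomial_mem (g : E.Generator) (m) :
    G.gen g * G.monomial m ∈ G.monomialSpan K := by
  classical
  cases g with
  | vertex v => exact G.vert_mul_monomial_mem K v m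
  | edge e =>
    have := G.monomial_mem K ⟨e :: m.1, m.2⟩
    simpa only [LeavittFamily.monomial, LeavittFamily.edgeProd, LeavittFamily.gen, mul_assoc]
      using this
  | ghost e =>
    obtain ⟨α, w, β⟩ := m
    change G.ghost e * _ ∈ _
    cases α with
    | nil =>
      by_cases h : E.source e = w
      · have := G.monomial_mem K ⟨[], E.range e, β ++ [e]⟩
        simp only [LeavittFamily.monomial, LeavittFamily.edgeProd, one_mul,
          G.ghostProd_concat] at this ⊢
        rw [← mul_assoc, G.range_mul_ghost] at this
        rwa [← mul_assoc, ← h, G.ghost_mul_source]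
      · simp only [LeavittFamily.monomial, LeavittFamily.edgeProd, one_mul]
        rw [← G.ghost_mul_source, mul_assoc, ← mul_assoc (G.vert _), G.vert_mul_of_ne _ _ h,
          zero_mul, mul_zero]
        exact zero_mem _
    | cons f α =>
      have h1 : G.ghost e * G.monomial (f :: α, w, β) =
          G.ghost e * G.edge f * G.monomial (α, w, β) := by
        simp only [LeavittFamily.monomial, LeavittFamily.edgeProd, mul_assoc]
      rw [h1]
      by_cases h : e = f
      · rw [h, G.ghost_mul_self]
        exact G.vert_mul_monomial_mem K _ _
      · rw [G.ghost_mul_of_ne _ _ h, zero_mul]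
        exact zero_mem _

/-- The span is stable under left multiplication by `L(E)` and contains the vertices, hence contains
`x = x ∑ v`. -/
theorem mem_monomialSpan {x : E.UnitalLeavittAlgebra K} (hx : x ∈ unitalSubalgebra E K) :
    x ∈ (E.universalFamily K).monomialSpan K := by
  have key : ∀ m ∈ (E.universalFamily K).monomialSpan K,
      x * m ∈ (E.universalFamily K).monomialSpan K := by
    induction hx using NonUnitalAlgebra.adjoin_induction with
    | mem x hx =>
      obtain ⟨g, rfl⟩ := hx
      rw [← universalFamily_gen]
      intro m hm
      refine Submodule.span_induction (p := fun m _ =>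
        (E.universalFamily K).gen g * m ∈ (E.universalFamily K).monomialSpan K) ?_ ?_ ?_ ?_ hm
      · rintro _ ⟨m, rfl⟩
        exact (E.universalFamily K).gen_mul_monomial_mem K g m
      · rw [mul_zero]; exact zero_mem _
      · intro y z _ _ hy hz
        rw [mul_add]; exact add_mem hy hz
      · intro k y _ hy
        rw [mul_smul_comm]; exact Submodule.smul_mem _ k hy
    | add x y _ _ hx hy =>
      intro m hm
      rw [add_mul]; exact add_mem (hx m hm) (hy m hm)
    | zero =>
      intro m _
      rw [zero_mul]; exact zero_mem _
    | mul x y _ _ hx hy =>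
      intro m hm
      rw [mul_assoc]; exact hx _ (hy m hm)
    | smul k x _ hx =>
      intro m hm
      rw [smul_mul_assoc]; exact Submodule.smul_mem _ k (hx m hm)
  obtain ⟨A, hA⟩ := exists_unitalVertexSum_mul hx
  rw [← (hA A subset_rfl).2]
  refine key _ (sum_mem fun v _ => ?_)
  have := (E.universalFamily K).monomial_mem K ⟨[], v, []⟩
  simpa [LeavittFamily.monomial, LeavittFamily.edgeProd, LeavittFamily.ghostProd] using this

/-- A nonzero product starting in a hereditary set `H` follows a path, which cannot leave `H`. This
confines the monomials of a corner to the edges emitted from `H`. -/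
theorem LeavittFamily.vert_mul_edgeProd {H : Set E.Vertex}
    (hH : ∀ e, E.source e ∈ H → E.range e ∈ H) (w : E.Vertex) (α : List E.Edge) {v : E.Vertex}
    (hv : v ∈ H) : G.vert v * G.edgeProd α * G.vert w = 0 ∨
      ((∀ e ∈ α, E.source e ∈ H) ∧ w ∈ H ∧
        G.vert v * G.edgeProd α * G.vert w = G.edgeProd α * G.vert w) := by
  induction α generalizing v with
  | nil =>
    simp only [LeavittFamily.edgeProd, mul_one, one_mul]
    by_cases h : v = w
    · subst h
      exact Or.inr ⟨by simp, hv, G.vert_mul_self v⟩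
    · exact Or.inl (G.vert_mul_of_ne _ _ h)
  | cons e α ih =>
    by_cases h : v = E.source e
    · subst h
      have h1 : G.vert (E.source e) * G.edgeProd (e :: α) * G.vert w =
          G.edge e * (G.vert (E.range e) * G.edgeProd α * G.vert w) := by
        simp only [LeavittFamily.edgeProd, ← mul_assoc, G.source_mul_edge, G.edge_mul_range]
      rcases ih (hH e hv) with h0 | ⟨h2, h3, h4⟩
      · left; rw [h1, h0, mul_zero]
      · refine Or.inr ⟨by simpa using ⟨hv, h2⟩, h3, ?_⟩
        rw [h1, h4, LeavittFamily.edgeProd, mul_assoc]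
    · left
      rw [LeavittFamily.edgeProd, ← G.source_mul_edge]
      simp only [← mul_assoc, G.vert_mul_of_ne _ _ h, zero_mul]

theorem LeavittFamily.ghostProd_mul_vert {H : Set E.Vertex}
    (hH : ∀ e, E.source e ∈ H → E.range e ∈ H) (w : E.Vertex) (β : List E.Edge) {v : E.Vertex}
    (hv : v ∈ H) : G.vert w * (G.ghostProd β * G.vert v) = 0 ∨
      ((∀ e ∈ β, E.source e ∈ H) ∧
        G.vert w * (G.ghostProd β * G.vert v) = G.vert w * G.ghostProd β) := by
  induction β generalizing v with
  | nil =>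
    simp only [LeavittFamily.ghostProd, mul_one, one_mul]
    by_cases h : w = v
    · subst h
      exact Or.inr ⟨by simp, G.vert_mul_self w⟩
    · exact Or.inl (G.vert_mul_of_ne _ _ h)
  | cons e β ih =>
    by_cases h : E.source e = v
    · subst h
      have h1 : G.vert w * (G.ghostProd (e :: β) * G.vert (E.source e)) =
          G.vert w * (G.ghostProd β * G.vert (E.range e)) * G.ghost e := by
        simp only [LeavittFamily.ghostProd, mul_assoc, G.ghost_mul_source, G.range_mul_ghost]
      rcases ih (hH e hv) with h0 | ⟨h2, h4⟩
      · left; rw [h1, h0, zero_mul]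
      · refine Or.inr ⟨by simpa using ⟨hv, h2⟩, ?_⟩
        rw [h1, h4, LeavittFamily.ghostProd, mul_assoc]
    · left
      rw [LeavittFamily.ghostProd, ← G.ghost_mul_source]
      simp only [mul_assoc, G.vert_mul_of_ne _ _ h, mul_zero]

/-- Closing a finite set under passing to ranges of emitted edges takes countably many steps, and
each keeps the set countable. -/
theorem exists_countable_hereditary (hE : ∀ v, (E.emitted v).Countable) (A : Finset E.Vertex) :
    ∃ H : Set E.Vertex, H.Countable ∧ (A : Set E.Vertex) ⊆ H ∧
      ∀ e, E.source e ∈ H → E.range e ∈ H := by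
  let step : Set E.Vertex → Set E.Vertex := fun S => ⋃ v ∈ S, E.range '' E.emitted v
  let H : ℕ → Set E.Vertex := fun n => step^[n] A
  have hc : ∀ n, (H n).Countable := fun n => by
    induction n with
    | zero => exact A.countable_toSet
    | succ n ih =>
      simp only [H, Function.iterate_succ_apply']
      exact ih.biUnion fun v _ => (hE v).image _
  refine ⟨⋃ n, H n, Set.countable_iUnion hc, Set.subset_iUnion H 0, fun e he => ?_⟩
  obtain ⟨n, hn⟩ := Set.mem_iUnion.1 he
  refine Set.mem_iUnion.2 ⟨n + 1, ?_⟩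
  simp only [H, Function.iterate_succ_apply']
  exact Set.mem_biUnion hn ⟨e, rfl, rfl⟩

/-- If no vertex emits uncountably many edges, then the corners `t L(E) t` are spanned by
countable sets. -/
theorem exists_countable_span_corner (hE : ∀ v, (E.emitted v).Countable) (A : Finset E.Vertex) :
    ∃ C : Set (E.UnitalLeavittAlgebra K), C.Countable ∧ ∀ x ∈ unitalSubalgebra E K,
      E.unitalVertexSum K A * x * E.unitalVertexSum K A ∈ Submodule.span K C := by
  obtain ⟨H, hHc, hAH, hH⟩ := exists_countable_hereditary hE A
  let Y : Set E.Edge := {e | E.source e ∈ H}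
  have hY : Y.Countable := by
    have : Y = ⋃ v ∈ H, E.emitted v := by
      ext e; simp [Y, emitted]
    rw [this]
    exact hHc.biUnion fun v _ => hE v
  have := hY.to_subtype
  have := hHc.to_subtype
  let G := E.universalFamily K
  let f : List Y × H × List Y → E.UnitalLeavittAlgebra K := fun m =>
    G.monomial (m.1.map Subtype.val, m.2.1, m.2.2.map Subtype.val)
  refine ⟨Set.range f, Set.countable_range f, fun x hx => ?_⟩
  have hxM := mem_monomialSpan K hx
  refine Submodule.span_induction (p := fun x _ =>
    E.unitalVertexSum K A * x * E.unitalVertexSum K A ∈ Submodule.span K (Set.range f))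
    ?_ ?_ ?_ ?_ hxM
  · rintro _ ⟨⟨α, w, β⟩, rfl⟩
    simp only [unitalVertexSum, Finset.sum_mul, Finset.mul_sum]
    refine sum_mem fun v' hv' => sum_mem fun v hv => ?_
    -- The idempotent `w` is doubled so that the two halves of the monomial can be treated
    -- separately.
    have h1 : G.vert v * G.monomial (α, w, β) * G.vert v' =
        (G.vert v * G.edgeProd α * G.vert w) * (G.vert w * (G.ghostProd β * G.vert v')) := by
      conv_lhs => rw [LeavittFamily.monomial, ← G.vert_mul_self w]
      simp only [mul_assoc]
    change G.vert v * G.monomial (α, w, β) * G.vert v' ∈ _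
    rw [h1]
    rcases G.vert_mul_edgeProd hH w α (hAH hv) with h2 | ⟨h2, h3, h4⟩
    · rw [h2, zero_mul]; exact zero_mem _
    · rcases G.ghostProd_mul_vert hH w β (hAH hv') with h5 | ⟨h5, h6⟩
      · rw [h5, mul_zero]; exact zero_mem _
      · rw [h4, h6]
        have hα : ∀ e ∈ α, e ∈ Y := h2
        have hβ : ∀ e ∈ β, e ∈ Y := h5
        lift α to List Y using hα
        lift β to List Y using hβ
        refine Submodule.subset_span ⟨(α, ⟨w, h3⟩, β), ?_⟩
        change G.edgeProd (α.map Subtype.val) * G.vert w * G.ghostProd (β.map Subtype.val) = _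
        conv_lhs => rw [← G.vert_mul_self w]
        simp only [mul_assoc]
  · rw [mul_zero, zero_mul]; exact zero_mem _
  · intro y z _ _ hy hz
    rw [mul_add, add_mul]; exact add_mem hy hz
  · intro k y _ hy
    rw [mul_smul_comm, smul_mul_assoc]; exact Submodule.smul_mem _ k hy

end Monomials

end DirectedGraph

/-! ### Counting orthogonal idempotent endomorphisms -/

section OrthogonalIdempotents

attribute [-instance] Unitization.instNonAssocSemiring Unitization.instNonAssocRing
  Unitization.instSemiring Unitization.instMonoid Unitization.instMulOneClass

local infixr:73 " ⊳ " => nuAct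

/-- If a corner `t S t` has countable dimension, then every module generated by finitely many
elements fixed by `t` has only countably many pairwise orthogonal nonzero idempotent
endomorphisms. -/
theorem countable_of_orthogonal_endomorphisms {K : Type*} [Field K] {S : Type t} [NonUnitalRing S]
    [Module K S] [IsScalarTower K S S] [SMulCommClass K S S] {t : S} (ht : t * t = t)
    {W : Submodule K S} (hW : Module.rank K W ≤ Cardinal.aleph0) (htW : ∀ x, t * x * t ∈ W)
    {M : Type t} [AddCommGroup M] [Module (Unitization ℤ S) M] {s : Finset M}
    (hs : Submodule.span (Unitization ℤ S) (s : Set M) = ⊤) (hts : ∀ q ∈ s, t ⊳ q = q)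
    {I : Type*} (ε : I → M →ₗ[Unitization ℤ S] M) (hne : ∀ i, ε i ≠ 0)
    (hidem : ∀ i m, ε i (ε i m) = ε i m) (horth : ∀ i j, i ≠ j → ∀ m, ε i (ε j m) = 0) :
    Countable I := by
  have h1 : ∀ i, ∃ q ∈ s, ε i q ≠ 0 := fun i => by
    by_contra! h
    exact hne i (LinearMap.ext_on hs fun q hq => h q hq)
  choose q hqs hq using h1
  have hfix : ∀ i, t ⊳ ε i (q i) = ε i (q i) := fun i => by
    rw [← map_nuAct, hts _ (hqs i)]
  -- Writing `m = ∑ c x` over the generators and using `m = t m` and `x = t x`, the coefficients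
  -- become `t c t`, hence lie in `W`. So a vector fixed by `t` is encoded by an element of the
  -- power `W^s`.
  have h2 : ∀ m : M, t ⊳ m = m → ∃ w : s → W, m = ∑ x, (w x : S) ⊳ (x : M) := by
    intro m hm
    have hmem : m ∈ Submodule.span (Unitization ℤ S) (s : Set M) := by rw [hs]; trivial
    obtain ⟨c, -, hc⟩ := Submodule.mem_span_finset.1 hmem
    refine ⟨fun x => ⟨_, htW ((c x).fst • t + (c x).snd)⟩, ?_⟩
    rw [← hm, ← hc, nuAct_sum, ← Finset.sum_coe_sort]
    refine Finset.sum_congr rfl fun x _ => ?_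
    have h3 := congrArg (fun y => t ⊳ (c x • y)) (hts x x.2)
    refine h3.symm.trans ?_
    rw [nuAct_smul, ← mul_nuAct]
    change _ = (t * ((c x).fst • t + (c x).snd) * t) ⊳ (x : M)
    rw [mul_add, mul_smul_comm, ht]
  choose w hw using fun i => h2 _ (hfix i)
  have hli : LinearIndependent K w := by
    rw [linearIndependent_iff']
    intro fs g hg j hj
    by_contra hgj
    -- No action of `K` on `M` is given, so the scalars act through `g i • t`. Applying `ε j` to
    -- this relation isolates its term with index `j`, and `g j` is then cancelled.
    have hz : ∑ i ∈ fs, (g i • t) ⊳ ε i (q i) = 0 := by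
      have : ∀ i ∈ fs, (g i • t) ⊳ ε i (q i) = ∑ x : s, (t * (g i • (w i x : S))) ⊳ (x : M) := by
        intro i _
        conv_lhs => rw [hw i]
        rw [nuAct_sum]
        refine Finset.sum_congr rfl fun x _ => ?_
        rw [← mul_nuAct, smul_mul_assoc, mul_smul_comm]
      rw [Finset.sum_congr rfl this, Finset.sum_comm]
      refine Finset.sum_eq_zero fun x _ => ?_
      rw [← sum_nuAct, ← Finset.mul_sum]
      have hx : ∑ i ∈ fs, g i • (w i x : S) = 0 := by
        have := congrArg (fun f : s → W => (f x : S)) hg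
        simpa using this
      rw [hx, mul_zero, zero_nuAct]
    have hz' : (g j • t) ⊳ ε j (q j) = 0 := by
      have h3 := congrArg (ε j) hz
      rw [map_sum, map_zero, Finset.sum_eq_single j] at h3
      · rwa [map_nuAct, hidem] at h3
      · intro i _ hi
        rw [map_nuAct, horth j i hi.symm, nuAct_zero]
      · exact fun h => absurd hj h
    have h4 : ((g j)⁻¹ • t) ⊳ (g j • t) ⊳ ε j (q j) = ε j (q j) := by
      rw [← mul_nuAct, smul_mul_assoc, mul_smul_comm, smul_smul, inv_mul_cancel₀ hgj, one_smul, ht,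
        hfix]
    rw [hz', nuAct_zero] at h4
    exact hq j h4.symm
  have h5 := hli.cardinal_lift_le_rank
  have h6 : Module.rank K (s → W) ≤ Cardinal.aleph0 := by
    rw [rank_fun_eq_lift_mul]
    exact (mul_le_mul' (Cardinal.natCast_lt_aleph0).le (Cardinal.lift_le_aleph0.2 hW)).trans
      Cardinal.aleph0_mul_aleph0.le
  rw [← Cardinal.mk_le_aleph0_iff, ← Cardinal.lift_le_aleph0]
  exact h5.trans (Cardinal.lift_le_aleph0.2 h6)

/-- Orthogonal idempotents below an idempotent of `R` give orthogonal idempotent endomorphisms of a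
finitely generated module over a ring Morita equivalent to `R`. -/
theorem exists_orthogonal_endomorphisms {R S : Type t} [NonUnitalRing R] [NonUnitalRing S]
    (hR : HasLocalUnits R) (hS : HasLocalUnits S) (Φ : UnitalModuleCat R ≌ UnitalModuleCat S)
    {I : Type*} {v : R} (hv : v * v = v) (p : I → R) (hvp : ∀ i, v * p i = p i)
    (hpv : ∀ i, p i * v = p i) (hne : ∀ i, p i ≠ 0) (hidem : ∀ i, p i * p i = p i)
    (horth : ∀ i j, i ≠ j → p i * p j = 0) :
    ∃ (Q : UnitalModuleCat S) (s : Finset Q.obj)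
      (ε : I → Q.obj →ₗ[Unitization ℤ S] Q.obj),
      Submodule.span (Unitization ℤ S) (s : Set Q.obj) = ⊤ ∧ (∀ i, ε i ≠ 0) ∧
      (∀ i m, ε i (ε i m) = ε i m) ∧ ∀ i j, i ≠ j → ∀ m, ε i (ε j m) = 0 := by
  -- This is the left ideal `Rv`, as `v = v v`. The idempotents `p i` act on it by right
  -- multiplication, since `v (p i) = p i = (p i) v`.
  let N : Submodule (Unitization ℤ R) (Unitization ℤ R) :=
    Submodule.span (Unitization ℤ R) {(Unitization.inr v : Unitization ℤ R)}
  have hvN : (Unitization.inr v : Unitization ℤ R) ∈ N := Submodule.mem_span_singleton_self _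
  have hN : ∀ m ∈ N, m ∈ unitalPart R (Unitization ℤ R) := by
    suffices N ≤ unitalPart R (Unitization ℤ R) from this
    refine (Submodule.span_singleton_le_iff_mem _ _).2 ?_
    have : v ⊳ (Unitization.inr v : Unitization ℤ R) = Unitization.inr v := by
      change Unitization.inr v * Unitization.inr v = _
      rw [← Unitization.inr_mul, hv]
    rw [← this]
    exact nuAct_mem_unitalPart _ _
  let X : UnitalModuleCat R := ⟨ModuleCat.of _ N, hR.isUnitalModule_of_submodule N hN⟩
  have hpN : ∀ i, ∀ x ∈ N, LinearMap.toSpanSingleton (Unitization ℤ R) (Unitization ℤ R)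
      (Unitization.inr (p i)) x ∈ N := by
    intro i
    suffices N ≤ N.comap (LinearMap.toSpanSingleton (Unitization ℤ R) (Unitization ℤ R)
      (Unitization.inr (p i))) from this
    refine (Submodule.span_singleton_le_iff_mem _ _).2 ?_
    change (Unitization.inr v * Unitization.inr (p i) : Unitization ℤ R) ∈ N
    rw [← Unitization.inr_mul, hvp, ← hpv, Unitization.inr_mul]
    exact N.smul_mem (Unitization.inr (p i)) hvN
  let T : I → N →ₗ[Unitization ℤ R] N := fun i => LinearMap.restrict _ (hpN i)
  have hT : ∀ i x, (T i x : Unitization ℤ R) = (x : Unitization ℤ R) * Unitization.inr (p i) := fun _ _ => rfl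
  let τ : I → (X ⟶ X) := fun i => ObjectProperty.homMk (ModuleCat.ofHom (T i))
  have hτ1 : ∀ i, τ i ≫ τ i = τ i := fun i => by
    refine UnitalModuleCat.hom_ext_apply fun x => ?_
    refine Subtype.ext ?_
    change (T i (T i x) : Unitization ℤ R) = T i x
    rw [hT, hT, unitization_mul_assoc, ← Unitization.inr_mul, hidem]
  have hτ2 : ∀ i j, i ≠ j → τ i ≫ τ j = 0 := fun i j hij => by
    refine UnitalModuleCat.hom_ext_apply fun x => ?_
    refine Subtype.ext ?_
    change (T j (T i x) : Unitization ℤ R) = 0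
    rw [hT, hT, unitization_mul_assoc, ← Unitization.inr_mul, horth i j hij, Unitization.inr_zero]
    exact smul_zero (A := Unitization ℤ R) (Subtype.val x)
  have hτ0 : ∀ i, τ i ≠ 0 := fun i h => by
    have h1 : T i = 0 := congrArg (fun f : X ⟶ X => f.hom.hom) h
    have h2 := hT i ⟨_, hvN⟩
    rw [h1, ← Unitization.inr_mul, hvp] at h2
    exact hne i (Unitization.inr_injective (R := ℤ) (h2.symm.trans (Unitization.inr_zero ℤ).symm))
  have hx : Submodule.span (Unitization ℤ R) {(⟨_, hvN⟩ : X.obj)} = ⊤ := by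
    refine Submodule.eq_top_iff'.2 fun y => ?_
    obtain ⟨a, ha⟩ := Submodule.mem_span_singleton.1 y.2
    exact Submodule.mem_span_singleton.2 ⟨a, Subtype.ext ha⟩
  obtain ⟨s, hs⟩ := exists_finset_span_eq_top hR hS Φ X _ hx
  refine ⟨Φ.functor.obj X, s, fun i => (Φ.functor.map (τ i)).hom.hom, hs, fun i h => ?_,
    fun i m => ?_, fun i j hij m => ?_⟩
  · refine hτ0 i (Φ.functor.map_injective ?_)
    rw [Functor.map_zero]
    ext1
    exact ModuleCat.hom_ext h
  · have := congrArg (fun f : X ⟶ X => (Φ.functor.map f).hom.hom m) (hτ1 i)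
    simpa using this
  · have := congrArg (fun f : X ⟶ X => (Φ.functor.map f).hom.hom m) (hτ2 j i hij.symm)
    simpa using this

end OrthogonalIdempotents

/-! ### Morita invariance of the absence of uncountable emitters -/

namespace DirectedGraph

variable (K : Type w) [Field K]

/-- If no vertex emits uncountably many edges, then the corners `t L(E) t` have countable
dimension. -/
theorem exists_rank_corner_le_aleph0 {F : DirectedGraph.{u}}
    (hF : ∀ v, (F.emitted v).Countable) (A : Finset F.Vertex) :
    ∃ W : Submodule K (F.LeavittPathAlgebra K), Module.rank K W ≤ Cardinal.aleph0 ∧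
      ∀ x, F.vertexSum K A * x * F.vertexSum K A ∈ W := by
  obtain ⟨C, hC, h⟩ := exists_countable_span_corner K hF A
  let ι : F.LeavittPathAlgebra K →ₗ[K] F.UnitalLeavittAlgebra K :=
    (NonUnitalSubalgebraClass.subtype (unitalSubalgebra F K) :
      F.LeavittPathAlgebra K →ₙₐ[K] F.UnitalLeavittAlgebra K)
  have hι : Function.Injective ι := Subtype.val_injective
  refine ⟨(Submodule.span K C).comap ι, ?_, fun x => ?_⟩
  · have h1 := LinearMap.rank_le_of_injective
      (ι.restrict (p := (Submodule.span K C).comap ι) (q := Submodule.span K C) fun _ hx => hx)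
      (fun x y hxy => Subtype.ext (hι (congrArg (fun z : Submodule.span K C => (z : F.UnitalLeavittAlgebra K)) hxy)))
    exact h1.trans ((rank_span_le C).trans hC.le_aleph0)
  · have h1 := h x x.2
    rwa [← coe_vertexSum] at h1

/-- If `L(E)` is Morita equivalent to `L(F)` and no vertex of `F` emits uncountably many edges, then
the same holds for `E`. -/
theorem countable_emitted_of_morita {E F : DirectedGraph.{u}}
    (hF : ∀ v, (F.emitted v).Countable)
    (h : MoritaEquivalentRings (E.LeavittPathAlgebra K) (F.LeavittPathAlgebra K)) (v : E.Vertex) :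
    (E.emitted v).Countable := by
  obtain ⟨Φ⟩ := h
  let G := E.universalFamily K
  let edge : E.Edge → E.LeavittPathAlgebra K := fun e =>
    ⟨E.unitalGenerator K (.edge e), NonUnitalAlgebra.subset_adjoin K ⟨_, rfl⟩⟩
  let ghost : E.Edge → E.LeavittPathAlgebra K := fun e =>
    ⟨E.unitalGenerator K (.ghost e), NonUnitalAlgebra.subset_adjoin K ⟨_, rfl⟩⟩
  have h1 : ∀ w, E.leavittVertex K w * E.leavittVertex K w = E.leavittVertex K w := fun w =>
    Subtype.ext (G.vert_mul_self w)
  have h2 : ∀ e, E.leavittVertex K (E.source e) * edge e = edge e := fun e =>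
    Subtype.ext (G.source_mul_edge e)
  have h3 : ∀ e, ghost e * E.leavittVertex K (E.source e) = ghost e := fun e =>
    Subtype.ext (G.ghost_mul_source e)
  have h4 : ∀ e, ghost e * edge e = E.leavittVertex K (E.range e) := fun e =>
    Subtype.ext (G.ghost_mul_self e)
  have h5 : ∀ e f, e ≠ f → ghost e * edge f = 0 := fun e f h =>
    Subtype.ext (G.ghost_mul_of_ne e f h)
  have h6 : ∀ e, edge e * E.leavittVertex K (E.range e) = edge e := fun e =>
    Subtype.ext (G.edge_mul_range e)
  -- Multiplying `ee*` by `e*` and `e` from outside gives `r(e)`, which is nonzero by the branching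
  -- representation.
  have h7 : ∀ e, edge e * ghost e ≠ 0 := fun e h0 => by
    have h8 : ghost e * (edge e * ghost e) * edge e = 0 := by rw [h0, mul_zero, zero_mul]
    rw [← mul_assoc, h4, mul_assoc, h4, h1] at h8
    exact unitalGenerator_vertex_ne_zero E K _ (congrArg Subtype.val h8)
  obtain ⟨Q, s, ε, hs, hne, hidem, horth⟩ := exists_orthogonal_endomorphisms
    (hasLocalUnits_leavittPathAlgebra E K) (hasLocalUnits_leavittPathAlgebra F K) Φ (h1 v)
    (fun e : E.emitted v => edge e * ghost e)
    (fun ⟨e, he⟩ => by obtain rfl : E.source e = v := he; rw [← mul_assoc, h2])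
    (fun ⟨e, he⟩ => by obtain rfl : E.source e = v := he; rw [mul_assoc, h3])
    (fun e => h7 e)
    (fun e => by
      rw [mul_assoc, ← mul_assoc (ghost e), h4, ← mul_assoc, h6])
    (fun e f hef => by
      rw [mul_assoc, ← mul_assoc (ghost e), h5 _ _ fun h => hef (Subtype.ext h), zero_mul,
        mul_zero])
  -- The generators have a common unit `r`, and `r` is fixed by a finite sum of vertices, which
  -- therefore fixes the generators too. Only for such sums are the corners known to have countable
  -- dimension.
  obtain ⟨r, -, hr⟩ := (hasLocalUnits_leavittPathAlgebra F K).exists_unit ∅ s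
    fun m _ => UnitalModuleCat.mem_unitalPart Q m
  obtain ⟨A, hA⟩ := exists_vertexSum_mul {r}
  obtain ⟨W, hW, hAW⟩ := exists_rank_corner_le_aleph0 K hF A
  refine Set.countable_coe_iff.1 (countable_of_orthogonal_endomorphisms
    (t := F.vertexSum K A) ?_ hW hAW hs (fun q hq => ?_) ε hne hidem horth)
  · refine Subtype.ext ?_
    simpa using unitalVertexSum_mul_self (E := F) (K := K) A
  · rw [← hr q hq, ← mul_nuAct, (hA r (by simp)).1]

theorem exists_edgeListing {E : DirectedGraph.{u}} (h : ∀ v : E.Vertex, ¬ E.IsUncountableEmitter v) :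
    Nonempty E.EdgeListing := by
  refine ⟨fun v hv => Nonempty.some ?_⟩
  have := (not_not.1 (h v)).to_subtype
  have := hv.to_subtype
  exact nonempty_equiv_of_countable

end DirectedGraph

theorem mainTheorem1 (K : Type w) [Field K] (E : DirectedGraph.{u}) :
    List.TFAE [
      ∃ F : DirectedGraph.{u}, DirectedGraph.IsRowFiniteEquivalent K E F,
      ∃ F : DirectedGraph.{u}, DirectedGraph.IsDesingularization K E F,
      ∃ L : E.EdgeListing, DirectedGraph.IsDesingularization K E (E.addTails L),
      ∀ v : E.Vertex, ¬ E.IsUncountableEmitter v] ∧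
    ∀ L : E.EdgeListing,
      DirectedGraph.IsDesingularization K E (E.addTails L) ∧
      ∃ φ : E.LeavittPathAlgebra K →ₙₐ[K] (E.addTails L).LeavittPathAlgebra K,
        Function.Injective φ ∧
        (∀ v : E.Vertex, φ (E.leavittVertex K v) =
          (E.addTails L).leavittVertex K (DirectedGraph.addTailsVertex L v)) ∧
        ∀ A : Finset E.Vertex,
          φ '' cornerSet (E.vertexSum K A) = cornerSet (φ (E.vertexSum K A)) := by
  refine ⟨?_, fun L => ⟨DirectedGraph.isDesingularization_addTails K L, DirectedGraph.tailHom K L,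
    DirectedGraph.tailHom_injective K L, DirectedGraph.tailHom_leavittVertex K L,
    DirectedGraph.image_cornerSet K L⟩⟩
  tfae_have 3 → 2 := fun ⟨L, hL⟩ => ⟨_, hL⟩
  tfae_have 2 → 1 := fun ⟨F, hF⟩ => ⟨F, fun v => (not_not.1 (hF.not_singular v)).2, hF.morita⟩
  tfae_have 1 → 4 := fun ⟨F, hF⟩ v hv =>
    hv (DirectedGraph.countable_emitted_of_morita K (fun w => (hF.rowFinite w).countable)
      hF.morita v)
  tfae_have 4 → 3 := fun h =>
    (DirectedGraph.exists_edgeListing h).elim fun L =>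
      ⟨L, DirectedGraph.isDesingularization_addTails K L⟩
  tfae_finish
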